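/- Conventions. Let $k\ge 1$. A *$k$-graph* is a countable category $\Lambda$ with a functor (the degree) $d:\Lambda\to\mathbb{N}^k$ such that whenever $d(\lambda)=m+n$ there are unique $\mu,\nu\in\Lambda$ with $d(\mu)=m$, $d(\nu)=n$ and $\lambda=\mu\nu$. Morphisms are called paths, $r(\lambda)$ and $s(\lambda)$ are the codomain and domain of $\lambda$, $\lambda\mu$ is defined when $s(\lambda)=r(\mu)$, $\Lambda^0$ is the set of objects (vertices, identified with their identity morphisms), and $v\Lambda^n=\{\lambda: r(\lambda)=v,\ d(\lambda)=n\}$. $\Lambda$ is *row-finite* if every $v\Lambda^n$ is finite and *has no sources* if every $v\Lambda^n$ is nonempty ($v\in\Lambda^0$, $n\in\mathbb{N}^k$). A set $H\subseteq\Lambda^0$ is *hereditary* if $r(\lambda)\in H$ implies $s(\lambda)\in H$ for all $\lambda\in\Lambda$, and *saturated* if $v\in H$ whenever $s(v\Lambda^n)\subseteq H$ for some $n\in\mathbb{N}^k$. Let $\mathcal{H}_\Lambda$ be the set of all saturated hereditary subsets of $\Lambda^0$; for $\mathcal{A}\subseteq\mathcal{H}_\Lambda$ let $\bigvee\mathcal{A}$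 be the smallest element of $\mathcal{H}_\Lambda$ containing every member of $\mathcal{A}$. Let $\Omega_k$ be the $k$-graph with vertex set $\mathbb{N}^k$ and exactly one path $(p,q)$, with range $p$, source $q$ and degree $q-p$, for each $p\le q$ in $\mathbb{N}^k$. An *infinite path* in $\Lambda$ is a degree-preserving functor $x:\Omega_k\to\Lambda$; its range is $x(0)$, and $\sigma^p(x)(m,n)=x(m+p,n+p)$. $\Lambda$ is *aperiodic* if every vertex is the range of an infinite path $x$ such that $\sigma^m(x)\ne\sigma^n(x)$ for all $m\neq n$ in $\mathbb{N}^k$. $\Lambda$ is *strongly aperiodic* if for every $H\in\mathcal{H}_\Lambda$ with $H\ne\Lambda^0$ the $k$-graph $\Lambda\setminus H$ (vertices $\Lambda^0\setminus H$, paths $\{\lambda: s(\lambda)\notin H\}$) is aperiodic. For a row-finite $k$-graph $\Lambda$ with no sources and a commutative ring $R$ with identity, the *Kumjian–Pask algebra* $\mathrm{KP}_R(\Lambda)$ is the universal (not necessarily unital) $R$-algebra generated by elements $p_v$ ($v\in\Lambda^0$), $s_\lambda$ and $s_{\lambda^*}$ ($\lambda\in\Lambda$), with $s_v=s_{v^*}=p_v$,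 subject to: the $p_v$ are mutually orthogonal idempotents; $s_\lambda s_\mu=s_{\lambda\mu}$ and $s_{\mu^*}s_{\lambda^*}=s_{(\lambda\mu)^*}$ when $s(\lambda)=r(\mu)$; $p_{r(\lambda)}s_\lambda=s_\lambda=s_\lambda p_{s(\lambda)}$ and $p_{s(\lambda)}s_{\lambda^*}=s_{\lambda^*}=s_{\lambda^*}p_{r(\lambda)}$; $s_{\lambda^*}s_\mu=\delta_{\lambda,\mu}\,p_{s(\lambda)}$ when $d(\lambda)=d(\mu)$; and $p_v=\sum_{\lambda\in v\Lambda^n}s_\lambda s_{\lambda^*}$ for all $v\in\Lambda^0$, $n\in\mathbb{N}^k$. For $H\in\mathcal{H}_\Lambda$ let $I_H$ be the (two-sided) ideal of $\mathrm{KP}_R(\Lambda)$ generated by $\{p_v: v\in H\}$. Write $\mathcal{L}(A)$ for the set of two-sided ideals of a ring $A$. **Theorem.** Let $\Lambda$ be a strongly aperiodic row-finite $k$-graph with no sources and let $R$ be a commutative ring with identity. 1. For every ideal $I$ of $\mathrm{KP}_R(\Lambda)$, $$I=\operatorname{span}_R\{r s_\lambda s_{\mu^*} : r\in R,\ \lambda,\mu\in\Lambda,\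 r p_{s(\mu)}\in I\}.$$ 2. Let $\mathcal{F}$ be the set of all functions $\pi:\mathcal{H}_\Lambda\to\mathcal{L}(R)$ such that $\pi\big(\bigvee\mathcal{A}\big)=\bigcap_{H\in\mathcal{A}}\pi(H)$ for all $\mathcal{A}\subseteq\mathcal{H}_\Lambda$ (the intersection over $\mathcal{A}=\varnothing$ being $R$). For $\pi\in\mathcal{F}$ the set $$\Gamma(\pi)=\operatorname{span}_R\{r s_\mu s_{\nu^*} : \text{there exists } H\in\mathcal{H}_\Lambda \text{ such that } r\in\pi(H) \text{ and } s_\mu s_{\nu^*}\in I_H\}$$ is an ideal of $\mathrm{KP}_R(\Lambda)$, and $\Gamma:\mathcal{F}\to\mathcal{L}(\mathrm{KP}_R(\Lambda))$ is a bijection. 3. For $\pi_1,\pi_2\in\mathcal{F}$, $\Gamma(\pi_1)\subseteq\Gamma(\pi_2)$ if and only if $\pi_1(H)\subseteq\pi_2(H)$ for all $H\in\mathcal{H}_\Lambda$. -/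

import Mathlib

open CategoryTheory

universe u v w

/-- A `k`-graph: a countable category `V` together with a degree functor to the additive monoid
`ℕ^k` that has the factorisation property.  A path `α` with range `r(α) = b` and source
`s(α) = a` is a morphism `α : a ⟶ b`; the product written `αβ` in the literature
(first `β`, then `α`, with `s(α) = r(β)`) is the Mathlib composition `β ≫ α`. -/
structure KGraph (k : ℕ) (V : Type u) [Category.{v} V] where
  countable_vertices : Countable V
  countable_paths : ∀ a b : V, Countable (a ⟶ b)
  /-- the degree map -/
  d : ∀ {a b : V}, (a ⟶ b) → (Fin k → ℕ)
  d_id : ∀ a : V, d (𝟙 a) = 0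
  d_comp : ∀ {a b c : V} (β : a ⟶ b) (α : b ⟶ c), d (β ≫ α) = d α + d β
  /-- every path of degree `m + n` factors uniquely as `μ ν` with `d μ = m` and `d ν = n` -/
  factorisation : ∀ {a c : V} (γ : a ⟶ c) (m n : Fin k → ℕ), d γ = m + n →
    ∃! x : (Σ b : V, (a ⟶ b) × (b ⟶ c)), d x.2.2 = m ∧ d x.2.1 = n ∧ x.2.1 ≫ x.2.2 = γ

/-- Paths of arbitrary source `s` and range `r`: the set of all morphisms of the category. -/
structure KPath (V : Type u) [Category.{v} V] where
  {s : V}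
  {r : V}
  hom : s ⟶ r

namespace KGraph

variable {k : ℕ} {V : Type u} [Category.{v} V]

/-- The degree of a path. -/
def deg (Λ : KGraph k V) (α : KPath V) : Fin k → ℕ := Λ.d α.hom

/-- The set `vΛ^n` of paths of range `v` and degree `n`. -/
def pathsTo (Λ : KGraph k V) (v : V) (n : Fin k → ℕ) : Set (KPath V) :=
  {α | α.r = v ∧ Λ.deg α = n}

/-- Each `vΛ^n` is finite. -/
def RowFinite (Λ : KGraph k V) : Prop := ∀ v n, (Λ.pathsTo v n).Finite

/-- Each `vΛ^n` is nonempty. -/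
def NoSources (Λ : KGraph k V) : Prop := ∀ v n, (Λ.pathsTo v n).Nonempty

/-- `s(HΛ) ⊆ H`. -/
def IsHereditary (_Λ : KGraph k V) (H : Set V) : Prop :=
  ∀ α : KPath V, α.r ∈ H → α.s ∈ H

/-- `v ∈ H` whenever `s(vΛ^n) ⊆ H` for some `n`. -/
def IsSaturated (Λ : KGraph k V) (H : Set V) : Prop :=
  ∀ (v : V) (n : Fin k → ℕ), (∀ α ∈ Λ.pathsTo v n, α.s ∈ H) → v ∈ H

/-- The collection of saturated hereditary sets of vertices. -/
def SatHer (Λ : KGraph k V) : Type u := {H : Set V // Λ.IsSaturated H ∧ Λ.IsHereditary H}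

/-- The smallest saturated hereditary set containing every member of `𝒜`, that is, the
intersection of all saturated hereditary sets that do. -/
def join (Λ : KGraph k V) (𝒜 : Set Λ.SatHer) : Λ.SatHer :=
  ⟨⋂ (H : Λ.SatHer) (_ : ∀ K ∈ 𝒜, K.1 ⊆ H.1), H.1, by
    refine ⟨fun v n h => ?_, fun α h => ?_⟩
    · simp only [Set.mem_iInter] at h ⊢
      exact fun H hH => H.2.1 v n fun α hα => h α hα H hH
    · simp only [Set.mem_iInter] at h ⊢
      exact fun H hH => H.2.2 α (h H hH)⟩

/-- An infinite path: a degree-preserving functor `Ω_k → Λ`.  The category `Ω_k` has the objects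
`ℕ^k` and, for `p ≤ q`, one morphism `(p, q)` of range `p`, source `q` and degree `q - p`, so it
is the category of the order dual of the partially ordered set `ℕ^k`. -/
structure InfinitePath (Λ : KGraph k V) where
  functor : (Fin k → ℕ)ᵒᵈ ⥤ V
  d_map : ∀ (p q : Fin k → ℕ) (h : p ≤ q),
    p + Λ.d (functor.map (homOfLE (OrderDual.toDual_le_toDual.2 h))) = q

/-- The range `x(0)` of an infinite path. -/
def InfinitePath.range {Λ : KGraph k V} (x : Λ.InfinitePath) : V :=
  x.functor.obj (OrderDual.toDual 0)

/-- The shift `σ^p`, with `σ^p(x)(m, n) = x(m + p, n + p)`. -/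
def InfinitePath.shift {Λ : KGraph k V} (p : Fin k → ℕ) (x : Λ.InfinitePath) :
    Λ.InfinitePath where
  functor :=
    (Monotone.functor
      (f := fun m : (Fin k → ℕ)ᵒᵈ => OrderDual.toDual (OrderDual.ofDual m + p))
      fun _ _ h => OrderDual.toDual_le_toDual.2
        (add_le_add_left (OrderDual.ofDual_le_ofDual.2 h) p)) ⋙ x.functor
  d_map m n h := by
    have h1 := x.d_map (m + p) (n + p) (add_le_add_left h p)
    rw [add_right_comm] at h1
    exact add_right_cancel h1

/-- Every vertex is the range of an infinite path `x` with `σ^m(x) ≠ σ^n(x)` for all `m ≠ n`. -/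
def IsAperiodic (Λ : KGraph k V) : Prop :=
  ∀ v : V, ∃ x : Λ.InfinitePath, x.range = v ∧ ∀ m n : Fin k → ℕ, m ≠ n → x.shift m ≠ x.shift n

/-- The `k`-graph `Λ \ H` for a hereditary set `H`: its vertices are those outside `H` and its
paths are those with source (hence also range) outside `H`. -/
def compl (Λ : KGraph k V) (H : Set V) (hH : Λ.IsHereditary H) :
    KGraph k (ObjectProperty.FullSubcategory fun v : V => v ∉ H) where
  countable_vertices := by
    have := Λ.countable_vertices
    exact Function.Injective.countable
      (f := fun x : ObjectProperty.FullSubcategory (fun v : V => v ∉ H) => x.obj)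
      (fun x y h => by cases x; cases y; cases h; rfl)
  countable_paths a b := by
    have := Λ.countable_paths a.obj b.obj
    exact Function.Injective.countable (f := fun g : a ⟶ b => g.hom)
      (fun x y h => ObjectProperty.hom_ext _ h)
  d g := Λ.d g.hom
  d_id a := Λ.d_id a.obj
  d_comp β α := Λ.d_comp β.hom α.hom
  factorisation {a c} γ m n h := by
    obtain ⟨⟨b, β, α⟩, ⟨h1, h2, h3⟩, huniq⟩ := Λ.factorisation γ.hom m n h
    refine ⟨⟨⟨b, fun hb => a.property (hH ⟨β⟩ hb)⟩,
      ObjectProperty.homMk β, ObjectProperty.homMk α⟩,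
      ⟨h1, h2, ObjectProperty.hom_ext _ h3⟩, ?_⟩
    rintro ⟨⟨b', hb'⟩, β', α'⟩ ⟨h1', h2', h3'⟩
    have := huniq ⟨b', β'.hom, α'.hom⟩ ⟨h1', h2', congrArg (fun g => g.hom) h3'⟩
    cases this
    rfl

/-- `Λ \ H` is aperiodic for every saturated hereditary set `H` other than the set of all
vertices. -/
def IsStronglyAperiodic (Λ : KGraph k V) : Prop :=
  ∀ H : Λ.SatHer, H.1 ≠ Set.univ → (Λ.compl H.1 H.2.2).IsAperiodic

/-- A Kumjian–Pask `Λ`-family in a (not necessarily unital) ring `A`: elements `p v` for the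
vertices `v`, `s α` for the paths and `t α` for the ghost paths (usually written `s_{α^*}`), with
the convention that `s` and `t` take the value `p v` at the path `v` of degree zero. -/
structure IsKumjianPaskFamily (Λ : KGraph k V) (hΛ : Λ.RowFinite) {A : Type*} [NonUnitalRing A]
    (p : V → A) (s t : KPath V → A) : Prop where
  s_id : ∀ v, s ⟨𝟙 v⟩ = p v
  t_id : ∀ v, t ⟨𝟙 v⟩ = p v
  p_mul_self : ∀ v, p v * p v = p v
  p_mul_of_ne : ∀ v w, v ≠ w → p v * p w = 0
  s_mul_s : ∀ {a b c : V} (α : b ⟶ c) (β : a ⟶ b), s ⟨α⟩ * s ⟨β⟩ = s ⟨β ≫ α⟩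
  t_mul_t : ∀ {a b c : V} (α : b ⟶ c) (β : a ⟶ b), t ⟨β⟩ * t ⟨α⟩ = t ⟨β ≫ α⟩
  p_mul_s : ∀ α : KPath V, p α.r * s α = s α
  s_mul_p : ∀ α : KPath V, s α * p α.s = s α
  p_mul_t : ∀ α : KPath V, p α.s * t α = t α
  t_mul_p : ∀ α : KPath V, t α * p α.r = t α
  t_mul_s_self : ∀ α : KPath V, t α * s α = p α.s
  t_mul_s_of_ne : ∀ α β : KPath V, Λ.deg α = Λ.deg β → α ≠ β → t α * s β = 0
  p_eq_sum : ∀ (v : V) (n : Fin k → ℕ), p v = ∑ α ∈ (hΛ v n).toFinset, s α * t α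

end KGraph

/-- Generators of the Kumjian–Pask algebra: vertices, paths and ghost paths. -/
inductive KPGen (V : Type u) [Category.{v} V] : Type (max u v)
  | vert (a : V)
  | path (α : KPath V)
  | ghost (α : KPath V)

namespace KPGen

variable {V : Type u} [Category.{v} V] (R : Type w) [CommRing R]

/-- The generator of the free algebra at a vertex. -/
abbrev P (a : V) : FreeAlgebra R (KPGen V) := FreeAlgebra.ι R (vert a)

/-- The generator of the free algebra at a path. -/
abbrev S (α : KPath V) : FreeAlgebra R (KPGen V) := FreeAlgebra.ι R (path α)

/-- The generator of the free algebra at a ghost path. -/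
abbrev T (α : KPath V) : FreeAlgebra R (KPGen V) := FreeAlgebra.ι R (ghost α)

end KPGen

namespace KGraph

variable {k : ℕ} {V : Type u} [Category.{v} V]

open KPGen in
/-- The defining relations of a Kumjian–Pask family. -/
inductive KPRel (R : Type w) [CommRing R] (Λ : KGraph k V) (hΛ : Λ.RowFinite) :
    FreeAlgebra R (KPGen V) → FreeAlgebra R (KPGen V) → Prop
  | s_id (a : V) : KPRel R Λ hΛ (S R ⟨𝟙 a⟩) (P R a)
  | t_id (a : V) : KPRel R Λ hΛ (T R ⟨𝟙 a⟩) (P R a)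
  | p_mul_self (a : V) : KPRel R Λ hΛ (P R a * P R a) (P R a)
  | p_mul_of_ne (a b : V) (h : a ≠ b) : KPRel R Λ hΛ (P R a * P R b) 0
  | s_mul_s {a b c : V} (α : b ⟶ c) (β : a ⟶ b) :
      KPRel R Λ hΛ (S R ⟨α⟩ * S R ⟨β⟩) (S R ⟨β ≫ α⟩)
  | t_mul_t {a b c : V} (α : b ⟶ c) (β : a ⟶ b) :
      KPRel R Λ hΛ (T R ⟨β⟩ * T R ⟨α⟩) (T R ⟨β ≫ α⟩)
  | p_mul_s (α : KPath V) : KPRel R Λ hΛ (P R α.r * S R α) (S R α)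
  | s_mul_p (α : KPath V) : KPRel R Λ hΛ (S R α * P R α.s) (S R α)
  | p_mul_t (α : KPath V) : KPRel R Λ hΛ (P R α.s * T R α) (T R α)
  | t_mul_p (α : KPath V) : KPRel R Λ hΛ (T R α * P R α.r) (T R α)
  | t_mul_s_self (α : KPath V) : KPRel R Λ hΛ (T R α * S R α) (P R α.s)
  | t_mul_s_of_ne (α β : KPath V) (h : Λ.deg α = Λ.deg β) (h' : α ≠ β) :
      KPRel R Λ hΛ (T R α * S R β) 0
  | p_eq_sum (a : V) (n : Fin k → ℕ) :
      KPRel R Λ hΛ (P R a) (∑ α ∈ (hΛ a n).toFinset, S R α * T R α)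

/-- The image of a generator in the unital `R`-algebra with the Kumjian–Pask relations. -/
def kpGen (R : Type w) [CommRing R] (Λ : KGraph k V) (hΛ : Λ.RowFinite) (g : KPGen V) :
    RingQuot (KPRel R Λ hΛ) :=
  RingQuot.mkAlgHom R (KPRel R Λ hΛ) (FreeAlgebra.ι R g)

/-- The non-unital subalgebra generated by the generators. -/
def kpSubalgebra (R : Type w) [CommRing R] (Λ : KGraph k V) (hΛ : Λ.RowFinite) :
    NonUnitalSubalgebra R (RingQuot (KPRel R Λ hΛ)) :=
  NonUnitalAlgebra.adjoin R (Set.range (kpGen R Λ hΛ))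

/-- The Kumjian–Pask algebra `KP_R(Λ)`, the universal (in general non-unital) `R`-algebra
generated by a Kumjian–Pask `Λ`-family: it is realised inside the universal unital algebra, its
unitization, as the non-unital subalgebra generated by the family.  See
`isKumjianPaskFamily` and `existsUnique_lift` for the universal property. -/
abbrev KumjianPask (R : Type w) [CommRing R] (Λ : KGraph k V) (hΛ : Λ.RowFinite) :
    Type (max u v w) :=
  kpSubalgebra R Λ hΛ

section Family

variable (R : Type w) [CommRing R] (Λ : KGraph k V) (hΛ : Λ.RowFinite)

/-- The element `p_a` of the universal family, for a vertex `a`. -/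
def p (a : V) : KumjianPask R Λ hΛ :=
  ⟨kpGen R Λ hΛ (.vert a), NonUnitalAlgebra.subset_adjoin R ⟨_, rfl⟩⟩

/-- The element `s_α` of the universal family, for a path `α`. -/
def s (α : KPath V) : KumjianPask R Λ hΛ :=
  ⟨kpGen R Λ hΛ (.path α), NonUnitalAlgebra.subset_adjoin R ⟨_, rfl⟩⟩

/-- The element `s_{α^*}` of the universal family, for the ghost path of a path `α`. -/
def t (α : KPath V) : KumjianPask R Λ hΛ :=
  ⟨kpGen R Λ hΛ (.ghost α), NonUnitalAlgebra.subset_adjoin R ⟨_, rfl⟩⟩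

theorem isKumjianPaskFamily : Λ.IsKumjianPaskFamily hΛ (p R Λ hΛ) (s R Λ hΛ) (t R Λ hΛ) := by
  have key : ∀ {x y}, KPRel R Λ hΛ x y →
      RingQuot.mkAlgHom R (KPRel R Λ hΛ) x = RingQuot.mkAlgHom R (KPRel R Λ hΛ) y :=
    fun h => RingQuot.mkAlgHom_rel R h
  have mul : ∀ {x y}, RingQuot.mkAlgHom R (KPRel R Λ hΛ) x * RingQuot.mkAlgHom R (KPRel R Λ hΛ) y =
      RingQuot.mkAlgHom R (KPRel R Λ hΛ) (x * y) := (map_mul _ _ _).symm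
  constructor
  · exact fun v => Subtype.ext (key (.s_id v))
  · exact fun v => Subtype.ext (key (.t_id v))
  · exact fun v => Subtype.ext (mul.trans (key (.p_mul_self v)))
  · exact fun v w h => Subtype.ext (mul.trans ((key (.p_mul_of_ne v w h)).trans (map_zero _)))
  · exact fun α β => Subtype.ext (mul.trans (key (.s_mul_s α β)))
  · exact fun α β => Subtype.ext (mul.trans (key (.t_mul_t α β)))
  · exact fun α => Subtype.ext (mul.trans (key (.p_mul_s α)))
  · exact fun α => Subtype.ext (mul.trans (key (.s_mul_p α)))
  · exact fun α => Subtype.ext (mul.trans (key (.p_mul_t α)))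
  · exact fun α => Subtype.ext (mul.trans (key (.t_mul_p α)))
  · exact fun α => Subtype.ext (mul.trans (key (.t_mul_s_self α)))
  · exact fun α β h h' => Subtype.ext (mul.trans ((key (.t_mul_s_of_ne α β h h')).trans (map_zero _)))
  · intro v n
    refine Subtype.ext ?_
    have h := key (.p_eq_sum v n)
    rw [map_sum] at h
    rw [show (p R Λ hΛ v : RingQuot (KPRel R Λ hΛ)) = _ from h]
    rw [AddSubmonoidClass.coe_finsetSum]
    exact Finset.sum_congr rfl fun α _ => map_mul _ _ _

theorem existsUnique_lift {A : Type*} [NonUnitalRing A] [Module R A] [IsScalarTower R A A]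
    [SMulCommClass R A A] {P : V → A} {S T : KPath V → A}
    (h : Λ.IsKumjianPaskFamily hΛ P S T) :
    ∃! φ : KumjianPask R Λ hΛ →ₙₐ[R] A, (∀ a, φ (p R Λ hΛ a) = P a) ∧
      (∀ α, φ (s R Λ hΛ α) = S α) ∧ ∀ α, φ (t R Λ hΛ α) = T α := by
  let g : KPGen V → A := fun x => match x with
    | .vert a => P a
    | .path α => S α
    | .ghost α => T α
  let f : FreeAlgebra R (KPGen V) →ₐ[R] Unitization R A :=
    FreeAlgebra.lift R fun x => (g x : Unitization R A)
  have hf : ∀ x, f (FreeAlgebra.ι R x) = (g x : Unitization R A) := fun x => by simp [f]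
  have hrel : ∀ ⦃x y⦄, KPRel R Λ hΛ x y → f x = f y := by
    intro x y hxy
    induction hxy <;>
      simp only [map_mul, map_sum, map_zero, KPGen.P, KPGen.S, KPGen.T, hf, g,
        ← Unitization.inr_mul]
    case p_eq_sum a n =>
      rw [h.p_eq_sum a n]
      exact map_sum (Unitization.inrNonUnitalAlgHom R A) _ _
    case s_id a => rw [h.s_id]
    case t_id a => rw [h.t_id]
    case p_mul_self a => rw [h.p_mul_self]
    case p_mul_of_ne a b hab => rw [h.p_mul_of_ne a b hab, Unitization.inr_zero]
    case s_mul_s α β => rw [h.s_mul_s]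
    case t_mul_t α β => rw [h.t_mul_t]
    case p_mul_s α => rw [h.p_mul_s]
    case s_mul_p α => rw [h.s_mul_p]
    case p_mul_t α => rw [h.p_mul_t]
    case t_mul_p α => rw [h.t_mul_p]
    case t_mul_s_self α => rw [h.t_mul_s_self]
    case t_mul_s_of_ne α β h1 h2 => rw [h.t_mul_s_of_ne α β h1 h2, Unitization.inr_zero]
  let F : RingQuot (KPRel R Λ hΛ) →ₐ[R] Unitization R A := RingQuot.liftAlgHom R ⟨f, hrel⟩
  have hF : ∀ x, F (kpGen R Λ hΛ x) = (g x : Unitization R A) := fun x => by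
    simp [F, kpGen, RingQuot.liftAlgHom_mkAlgHom_apply, hf]
  have hfst : ∀ x ∈ kpSubalgebra R Λ hΛ, (F x).fst = 0 := by
    intro x hx
    induction hx using NonUnitalAlgebra.adjoin_induction with
    | mem x hx => obtain ⟨y, rfl⟩ := hx; simp [hF]
    | add x y _ _ hx hy => simp [hx, hy]
    | zero => simp
    | mul x y _ _ hx hy => simp [hx]
    | smul r x _ hx => simp [hx]
  refine ⟨{ toFun := fun x => (F x.1).snd
            map_smul' := fun r x => by simp
            map_zero' := by simp
            map_add' := fun x y => by simp
            map_mul' := fun x y => by simp [hfst x.1 x.2, hfst y.1 y.2] }, ⟨?_, ?_, ?_⟩, ?_⟩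
  · exact fun a => by simp [p, hF, g]
  · exact fun a => by simp [s, hF, g]
  · exact fun a => by simp [t, hF, g]
  · rintro ψ ⟨h1, h2, h3⟩
    ext ⟨x, hx⟩
    induction hx using NonUnitalAlgebra.adjoin_induction with
    | mem x hx =>
      obtain ⟨y, rfl⟩ := hx
      cases y with
      | vert a => exact (h1 a).trans (by simp [hF, g])
      | path a => exact (h2 a).trans (by simp [hF, g])
      | ghost a => exact (h3 a).trans (by simp [hF, g])
    | add x y hx' hy' hx hy =>
      have := congrArg₂ (· + ·) hx hy
      simp only [← map_add] at this
      exact this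
    | zero => exact (map_zero ψ).trans (map_zero _).symm
    | mul x y hx' hy' hx hy =>
      have := congrArg₂ (· * ·) hx hy
      simp only [← map_mul] at this
      exact this
    | smul r x hx' hx =>
      have := congrArg (r • ·) hx
      simp only [← map_smul] at this
      exact this

/-- The two-sided ideal `I_H` generated by the elements `p_a` with `a ∈ H`. -/
def idealOf (H : Set V) : TwoSidedIdeal (KumjianPask R Λ hΛ) :=
  TwoSidedIdeal.span {x | ∃ a ∈ H, x = p R Λ hΛ a}

/-- The functions from saturated hereditary sets to ideals of `R` that send arbitrary joins to
intersections (in particular the empty join to the ideal `R`). -/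
def JoinToInf : Type (max u w) :=
  {π : Λ.SatHer → Ideal R // ∀ 𝒜 : Set Λ.SatHer, π (Λ.join 𝒜) = ⨅ H ∈ 𝒜, π H}

/-- The `R`-linear span of the elements `r s_μ s_{ν^*}` for which some saturated hereditary `H`
has `r ∈ π(H)` and `s_μ s_{ν^*} ∈ I_H`. -/
def gammaSpan (π : Λ.SatHer → Ideal R) : Submodule R (KumjianPask R Λ hΛ) :=
  Submodule.span R {x | ∃ (r : R) (μ ν : KPath V), x = r • (s R Λ hΛ μ * t R Λ hΛ ν) ∧
    ∃ H : Λ.SatHer, r ∈ π H ∧ s R Λ hΛ μ * t R Λ hΛ ν ∈ idealOf R Λ hΛ H.1}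

end Family

end KGraph

/-!
The proof is elementary: it needs no uniqueness theorem and no graded ideals.

*Coefficients.* The elements `s_α s_{β^*}` with `s(α) = s(β)` span the algebra, and a product
`s_{β^*} s_γ` is a sum of elements `s_ε s_{η^*}` with `βε = γη` (`t_mul_s_mem`).  Hence a family of
ideals `D a` of `R`, one for each vertex `a`, that grows along paths defines a two-sided ideal
`coeffIdeal D`, the span of the `r s_α s_{β^*}` with `r ∈ D (s(β))`.

*Every ideal has this form* (`mem_ideal_iff`), with `D a` the set of the `r` with `r p_a ∈ I`.
Write `x ∈ I` as a combination of distinct `s_α s_{β^*}` with all `β` of the same degree.  Let `r` be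
one of the coefficients.  The `a` with `r p_a ∈ I` form a saturated hereditary set.  If `s(β)` were not
in it, strong aperiodicity would give an aperiodic path `y` with range `s(β)` in its complement,
and the compression of `x` by `s_{α y(0, q)}` and `s_{β y(0, q)}` would be `r p_{y(q)} ∈ I` for large `q`,
which is a contradiction (`coeff_smul_p_mem`).

*Different saturated families give different ideals* (`mem_of_smul_p_mem_coeffSpan`).  The algebra
acts on the functions `KPath V → R` modulo those whose value at `λ` lies in `D (s(λ))` for all `λ`
of large degree.  The elements of `coeffIdeal D` act as zero, and `r p_a` kills the class of the
constant function `1` only if `r ∈ D (s(λ))` for all `λ` of some degree with range `a`, that is, if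
`r ∈ D a`.

*Lattice.* A function `π` that sends joins to intersections is the same thing as a hereditary and
saturated family `D`: take for `D a` the ideal `π(H)`, where `H` is the saturated hereditary set
generated by `a` (`JoinToInf.mem_iff`).  Then `Γ(π)` is `coeffIdeal D` (`gammaSpan_eq`).
-/

/-! ### Composition of paths -/

namespace KPath

variable {V : Type u} [Category.{v} V]

/-- The product `αβ` of two paths with `s(α) = r(β)`.  The equality of vertices is only
propositional, whence the `eqToHom`. -/
def comp (α β : KPath V) (h : α.s = β.r) : KPath V :=
  ⟨β.hom ≫ eqToHom h.symm ≫ α.hom⟩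

@[simp] theorem comp_s (α β : KPath V) (h : α.s = β.r) : (α.comp β h).s = β.s := rfl

theorem comp_assoc (α β γ : KPath V) (h : α.s = β.r) (h' : β.s = γ.r) :
    (α.comp β h).comp γ h' = α.comp (β.comp γ h') h := by
  simp [comp]

theorem id_comp {a : V} (α : KPath V) (h : a = α.r) : comp ⟨𝟙 a⟩ α h = α := by
  subst h
  simp [comp]

theorem mk_comp_mk {a b c : V} (f : b ⟶ c) (g : a ⟶ b) : comp ⟨f⟩ ⟨g⟩ rfl = ⟨g ≫ f⟩ := by
  simp [comp]

end KPath

namespace KGraph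

variable {k : ℕ} {V : Type u} [Category.{v} V] (Λ : KGraph k V)

theorem deg_comp (α β : KPath V) (h : α.s = β.r) :
    Λ.deg (α.comp β h) = Λ.deg α + Λ.deg β := by
  obtain ⟨a⟩ := α
  obtain ⟨b⟩ := β
  dsimp only at h
  subst h
  simp [KPath.comp, deg, Λ.d_comp]

theorem exists_eq_comp {γ : KPath V} {m n : Fin k → ℕ} (h : Λ.deg γ = m + n) :
    ∃ (α β : KPath V) (hc : α.s = β.r), Λ.deg α = m ∧ Λ.deg β = n ∧ α.comp β hc = γ := by
  obtain ⟨g⟩ := γ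
  obtain ⟨⟨b, β, α⟩, ⟨h1, h2, h3⟩, -⟩ := Λ.factorisation g m n h
  refine ⟨⟨α⟩, ⟨β⟩, rfl, h1, h2, ?_⟩
  subst h3
  simp [KPath.comp]

variable {Λ} in
/-- Unique factorisation: equal products whose left factors have equal degrees have equal
factors. -/
theorem comp_inj {α β α' β' : KPath V} {h : α.s = β.r} {h' : α'.s = β'.r}
    (he : α.comp β h = α'.comp β' h') (hd : Λ.deg α = Λ.deg α') : α = α' ∧ β = β' := by
  have hd2 : Λ.deg β = Λ.deg β' := by
    have := congrArg Λ.deg he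
    rw [deg_comp, deg_comp, hd] at this
    exact add_left_cancel this
  obtain ⟨a⟩ := α
  obtain ⟨b⟩ := β
  obtain ⟨a'⟩ := α'
  obtain ⟨b'⟩ := β'
  dsimp only at h h'
  subst h h'
  simp only [KPath.comp, eqToHom_refl, Category.id_comp, KPath.mk.injEq] at he
  obtain ⟨rfl, rfl, he⟩ := he
  have he := eq_of_heq he
  obtain ⟨x, -, hu⟩ := Λ.factorisation (b ≫ a) _ _ (Λ.d_comp b a)
  have h1 := hu ⟨_, b, a⟩ ⟨rfl, rfl, rfl⟩
  have h2 := hu ⟨_, b', a'⟩ ⟨hd.symm, hd2.symm, he.symm⟩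
  have h3 := h1.trans h2.symm
  cases h3
  exact ⟨rfl, rfl⟩

/-! ### Products in the Kumjian–Pask algebra -/

section Algebra

variable (R : Type w) [CommRing R] (hΛ : Λ.RowFinite)

local notation "fam" => isKumjianPaskFamily R Λ hΛ

theorem s_comp (α β : KPath V) (h : α.s = β.r) :
    s R Λ hΛ (α.comp β h) = s R Λ hΛ α * s R Λ hΛ β := by
  obtain ⟨a⟩ := α
  obtain ⟨b⟩ := β
  dsimp only at h
  subst h
  simp [KPath.comp, (fam).s_mul_s]

theorem t_comp (α β : KPath V) (h : α.s = β.r) :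
    t R Λ hΛ (α.comp β h) = t R Λ hΛ β * t R Λ hΛ α := by
  obtain ⟨a⟩ := α
  obtain ⟨b⟩ := β
  dsimp only at h
  subst h
  simp [KPath.comp, (fam).t_mul_t]

theorem s_mul_t_of_ne {α β : KPath V} (h : α.s ≠ β.s) : s R Λ hΛ α * t R Λ hΛ β = 0 := by
  rw [← (fam).s_mul_p α, ← (fam).p_mul_t β, mul_assoc, ← mul_assoc (p R Λ hΛ _),
    (fam).p_mul_of_ne _ _ h, zero_mul, mul_zero]

theorem t_mul_s_of_range_ne {α β : KPath V} (h : α.r ≠ β.r) : t R Λ hΛ α * s R Λ hΛ β = 0 := by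
  rw [← (fam).t_mul_p α, ← (fam).p_mul_s β, mul_assoc, ← mul_assoc (p R Λ hΛ _),
    (fam).p_mul_of_ne _ _ h, zero_mul, mul_zero]

theorem s_mul_p_mul_t (α : KPath V) {β : KPath V} {v : V} (h : v = β.s) :
    s R Λ hΛ α * p R Λ hΛ v * t R Λ hΛ β = s R Λ hΛ α * t R Λ hΛ β := by
  rw [h, mul_assoc, (fam).p_mul_t]

theorem t_mul_p_mul_s (α : KPath V) {β : KPath V} {v : V} (h : v = β.r) :
    t R Λ hΛ α * p R Λ hΛ v * s R Λ hΛ β = t R Λ hΛ α * s R Λ hΛ β := by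
  rw [h, mul_assoc, (fam).p_mul_s]

/-- The product `s_{β^*} s_γ` is a sum of elements `s_ε s_{η^*}` with `βε = γη`: insert
`p_{r(β)} = ∑ s_λ s_{λ^*}`, the sum over the `λ` of degree `d(β) ⊔ d(γ)`, in the middle. -/
theorem t_mul_s_mem {S : Type*} [SetLike S (KumjianPask R Λ hΛ)]
    [AddSubmonoidClass S (KumjianPask R Λ hΛ)] (W : S) (β γ : KPath V)
    (hW : ∀ (ε η : KPath V) (h1 : β.s = ε.r) (h2 : γ.s = η.r), β.comp ε h1 = γ.comp η h2 →
      s R Λ hΛ ε * t R Λ hΛ η ∈ W) :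
    t R Λ hΛ β * s R Λ hΛ γ ∈ W := by
  by_cases hr : β.r = γ.r
  swap
  · rw [t_mul_s_of_range_ne Λ R hΛ hr]
    exact zero_mem W
  rw [← t_mul_p_mul_s Λ R hΛ β hr, (fam).p_eq_sum β.r (Λ.deg β ⊔ Λ.deg γ), Finset.mul_sum,
    Finset.sum_mul]
  refine sum_mem fun l hl => ?_
  obtain ⟨hlr, hld⟩ := (hΛ _ _).mem_toFinset.1 hl
  obtain ⟨b, ε, hb, hbd, -, hbl⟩ := Λ.exists_eq_comp (γ := l)
    (hld.trans (add_tsub_cancel_of_le (le_sup_left : Λ.deg β ≤ Λ.deg β ⊔ Λ.deg γ)).symm)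
  obtain ⟨c, η, hc, hcd, -, hcl⟩ := Λ.exists_eq_comp (γ := l)
    (hld.trans (add_tsub_cancel_of_le (le_sup_right : Λ.deg γ ≤ Λ.deg β ⊔ Λ.deg γ)).symm)
  have e : t R Λ hΛ β * (s R Λ hΛ l * t R Λ hΛ l) * s R Λ hΛ γ =
      (t R Λ hΛ β * s R Λ hΛ b) * s R Λ hΛ ε * (t R Λ hΛ η * (t R Λ hΛ c * s R Λ hΛ γ)) := by
    conv_lhs => rw [← hbl, s_comp, hbl, ← hcl, t_comp]
    simp only [mul_assoc]
  rw [e]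
  by_cases h1 : β = b
  swap
  · rw [(fam).t_mul_s_of_ne _ _ hbd.symm h1, zero_mul, zero_mul]
    exact zero_mem W
  by_cases h2 : c = γ
  swap
  · rw [(fam).t_mul_s_of_ne _ _ hcd h2, mul_zero, mul_zero]
    exact zero_mem W
  subst h1 h2
  rw [(fam).t_mul_s_self, (fam).t_mul_s_self, hb, (fam).p_mul_s, hc, (fam).t_mul_p]
  exact hW ε η hb hc (hbl.trans hcl.symm)

/-- The product `s_α s_{β^*} s_γ s_{δ^*}` is a sum of elements `s_{αε} s_{(δη)^*}` with
`βε = γη`. -/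
theorem mul_mem_of_forall (W : Submodule R (KumjianPask R Λ hΛ)) {α β γ δ : KPath V}
    (hαβ : α.s = β.s) (hγδ : γ.s = δ.s)
    (hW : ∀ (ε η : KPath V) (h1 : β.s = ε.r) (h2 : γ.s = η.r), β.comp ε h1 = γ.comp η h2 →
      s R Λ hΛ (α.comp ε (hαβ.trans h1)) * t R Λ hΛ (δ.comp η (hγδ.symm.trans h2)) ∈ W) :
    (s R Λ hΛ α * t R Λ hΛ β) * (s R Λ hΛ γ * t R Λ hΛ δ) ∈ W := by
  have := t_mul_s_mem Λ R hΛ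
    (W.comap ((LinearMap.mulRight R (t R Λ hΛ δ)).comp (LinearMap.mulLeft R (s R Λ hΛ α)))) β γ
    fun ε η h1 h2 h => by
      have := hW ε η h1 h2 h
      rw [s_comp, t_comp] at this
      simpa [mul_assoc] using this
  simpa [mul_assoc] using this

/-- The span of the `r s_α s_{β^*}` with `s(α) = s(β)` and `r` in the ideal of coefficients
attached to the vertex `s(β)`. -/
def coeffSpan (D : V → Ideal R) : Submodule R (KumjianPask R Λ hΛ) :=
  Submodule.span R {x | ∃ (r : R) (α β : KPath V), α.s = β.s ∧ r ∈ D β.s ∧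
    x = r • (s R Λ hΛ α * t R Λ hΛ β)}

variable {Λ R hΛ}

theorem smul_mem_coeffSpan {D : V → Ideal R} {r : R} (α β : KPath V) (hr : r ∈ D β.s) :
    r • (s R Λ hΛ α * t R Λ hΛ β) ∈ coeffSpan Λ R hΛ D := by
  by_cases h : α.s = β.s
  · exact Submodule.subset_span ⟨r, α, β, h, hr, rfl⟩
  · rw [s_mul_t_of_ne Λ R hΛ h, smul_zero]
    exact zero_mem _

/-- The coefficients grow along paths. -/
def CoeffHereditary (D : V → Ideal R) : Prop := ∀ α : KPath V, D α.r ≤ D α.s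

theorem coeffSpan_mul_mem {D E F : V → Ideal R}
    (hF : ∀ (ε η : KPath V), ε.s = η.s → ∀ a ∈ D ε.r, ∀ b ∈ E η.r, a * b ∈ F η.s)
    {x y : KumjianPask R Λ hΛ} (hx : x ∈ coeffSpan Λ R hΛ D) (hy : y ∈ coeffSpan Λ R hΛ E) :
    x * y ∈ coeffSpan Λ R hΛ F := by
  induction hx, hy using Submodule.span_induction₂ with
  | mem_mem x y hx hy =>
    obtain ⟨a, α, β, hαβ, ha, rfl⟩ := hx
    obtain ⟨b, γ, δ, hγδ, hb, rfl⟩ := hy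
    rw [smul_mul_smul_comm]
    refine mul_mem_of_forall Λ R hΛ ((coeffSpan Λ R hΛ F).comap (LinearMap.lsmul R _ (a * b)))
      hαβ hγδ fun ε η h1 h2 h => smul_mem_coeffSpan _ _ (hF ε η ?_ a ?_ b ?_)
    · change (β.comp ε h1).s = (γ.comp η h2).s
      rw [h]
    · exact h1 ▸ ha
    · rw [← h2, hγδ]
      exact hb
  | zero_left y _ => rw [zero_mul]; exact zero_mem _
  | zero_right x _ => rw [mul_zero]; exact zero_mem _
  | add_left x y z _ _ _ hx hy => rw [add_mul]; exact add_mem hx hy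
  | add_right x y z _ _ _ hx hy => rw [mul_add]; exact add_mem hx hy
  | smul_left r x y _ _ h => rw [smul_mul_assoc]; exact Submodule.smul_mem _ _ h
  | smul_right r x y _ _ h => rw [mul_smul_comm]; exact Submodule.smul_mem _ _ h

theorem s_eq_s_mul_t (α : KPath V) : s R Λ hΛ α = s R Λ hΛ α * t R Λ hΛ ⟨𝟙 α.s⟩ := by
  rw [(fam).t_id, (fam).s_mul_p]

theorem t_eq_s_mul_t (α : KPath V) : t R Λ hΛ α = s R Λ hΛ ⟨𝟙 α.s⟩ * t R Λ hΛ α := by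
  rw [(fam).s_id, (fam).p_mul_t]

theorem p_eq_s_mul_t (a : V) : p R Λ hΛ a = s R Λ hΛ ⟨𝟙 a⟩ * t R Λ hΛ ⟨𝟙 a⟩ := by
  rw [(fam).s_id, (fam).t_id, (fam).p_mul_self]

theorem s_mul_t_mem_coeffSpan_top (α β : KPath V) :
    s R Λ hΛ α * t R Λ hΛ β ∈ coeffSpan Λ R hΛ fun _ => ⊤ := by
  rw [← one_smul R (_ * _)]
  exact smul_mem_coeffSpan α β Submodule.mem_top

/-- The elements `s_α s_{β^*}` span the Kumjian–Pask algebra. -/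
theorem mem_coeffSpan_top (x : KumjianPask R Λ hΛ) : x ∈ coeffSpan Λ R hΛ fun _ => ⊤ := by
  obtain ⟨x, hx⟩ := x
  induction hx using NonUnitalAlgebra.adjoin_induction with
  | mem x hx =>
    obtain ⟨g, rfl⟩ := hx
    cases g with
    | vert a =>
      change p R Λ hΛ a ∈ _
      rw [p_eq_s_mul_t]
      exact s_mul_t_mem_coeffSpan_top _ _
    | path α =>
      change s R Λ hΛ α ∈ _
      rw [s_eq_s_mul_t]
      exact s_mul_t_mem_coeffSpan_top _ _
    | ghost α =>
      change t R Λ hΛ α ∈ _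
      rw [t_eq_s_mul_t]
      exact s_mul_t_mem_coeffSpan_top _ _
  | add x y hx' hy' hx hy => exact add_mem hx hy
  | zero => exact zero_mem _
  | mul x y hx' hy' hx hy =>
    have := coeffSpan_mul_mem (F := fun _ => ⊤) (fun _ _ _ _ _ _ _ => Submodule.mem_top) hx hy
    exact this
  | smul r x hx' hx => exact Submodule.smul_mem _ r hx

/-- The span attached to hereditary coefficients, as an ideal. -/
def coeffIdeal (D : V → Ideal R) (hD : CoeffHereditary D) :
    TwoSidedIdeal (KumjianPask R Λ hΛ) :=
  TwoSidedIdeal.mk' (coeffSpan Λ R hΛ D) (zero_mem _) add_mem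
    (fun {x} hx => by
      have e : -x = (-1 : R) • x := Subtype.ext (neg_one_smul R x.1).symm
      exact e ▸ Submodule.smul_mem _ (-1 : R) hx)
    (fun {x _} hy => coeffSpan_mul_mem
      (fun _ η _ a _ _ hb => (D η.s).mul_mem_left a (hD η hb)) (mem_coeffSpan_top x) hy)
    (fun {_ y} hx => coeffSpan_mul_mem
      (fun ε η h _ ha b _ => h ▸ (D ε.s).mul_mem_right b (hD ε ha)) hx (mem_coeffSpan_top y))

theorem mem_coeffIdeal {D : V → Ideal R} {hD : CoeffHereditary D} {x : KumjianPask R Λ hΛ} :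
    x ∈ coeffIdeal D hD ↔ x ∈ coeffSpan Λ R hΛ D :=
  TwoSidedIdeal.mem_mk' _ _ _ _ _ _ _

/-! ### Ideals of the Kumjian–Pask algebra -/

/-- Finite sums of the `p_v` are local units. -/
theorem exists_local_unit (x : KumjianPask R Λ hΛ) :
    ∃ F : Finset V, ∀ G, F ⊆ G → (∑ a ∈ G, p R Λ hΛ a) * x = x := by
  classical
  have hx := mem_coeffSpan_top x
  induction hx using Submodule.span_induction with
  | mem x hx =>
    obtain ⟨r, α, β, -, -, rfl⟩ := hx
    refine ⟨{α.r}, fun G hG => ?_⟩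
    rw [mul_smul_comm, Finset.sum_mul, Finset.sum_eq_single α.r, ← mul_assoc, (fam).p_mul_s]
    · intro b _ hb
      rw [← (fam).p_mul_s α, mul_assoc, ← mul_assoc, (fam).p_mul_of_ne _ _ hb, zero_mul]
    · exact fun h => (h (Finset.singleton_subset_iff.1 hG)).elim
  | zero => exact ⟨∅, fun G _ => mul_zero _⟩
  | add x y _ _ hx hy =>
    obtain ⟨F, hF⟩ := hx
    obtain ⟨F', hF'⟩ := hy
    refine ⟨F ∪ F', fun G hG => ?_⟩
    rw [mul_add, hF G (Finset.union_subset_left hG), hF' G (Finset.union_subset_right hG)]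
  | smul r x _ hx =>
    obtain ⟨F, hF⟩ := hx
    exact ⟨F, fun G hG => by rw [mul_smul_comm, hF G hG]⟩

/-- By the local units, ideals are closed under scalars. -/
theorem ideal_smul_mem (I : TwoSidedIdeal (KumjianPask R Λ hΛ)) (r : R)
    {x : KumjianPask R Λ hΛ} (hx : x ∈ I) : r • x ∈ I := by
  obtain ⟨F, hF⟩ := exists_local_unit x
  rw [← hF F subset_rfl, ← smul_mul_assoc]
  exact I.mul_mem_left _ _ hx

theorem smul_s_mul_t_mem {I : TwoSidedIdeal (KumjianPask R Λ hΛ)} {r : R} (α β : KPath V)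
    (h : r • p R Λ hΛ β.s ∈ I) : r • (s R Λ hΛ α * t R Λ hΛ β) ∈ I := by
  rw [← s_mul_p_mul_t Λ R hΛ α (rfl : β.s = β.s), ← smul_mul_assoc, ← mul_smul_comm]
  exact I.mul_mem_right _ _ (I.mul_mem_left _ _ h)

/-- The ideal of the `x` with `r x ∈ I`. -/
def colonIdeal (I : TwoSidedIdeal (KumjianPask R Λ hΛ)) (r : R) :
    TwoSidedIdeal (KumjianPask R Λ hΛ) :=
  TwoSidedIdeal.mk' {x | r • x ∈ I} (by simp [I.zero_mem])
    (fun {x y} hx hy => by simpa using I.add_mem hx hy)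
    (fun {x} hx => by simpa using I.neg_mem hx)
    (fun {x y} hy => by simpa [mul_smul_comm] using I.mul_mem_left x _ hy)
    (fun {x y} hx => by simpa [smul_mul_assoc] using I.mul_mem_right _ y hx)

theorem mem_colonIdeal {I : TwoSidedIdeal (KumjianPask R Λ hΛ)} {r : R}
    {x : KumjianPask R Λ hΛ} : x ∈ colonIdeal I r ↔ r • x ∈ I :=
  TwoSidedIdeal.mem_mk' {x | r • x ∈ I} _ _ _ _ _ _

/-- If `r p_a ∈ I` for all `a ∈ H`, then `r I_H ⊆ I`. -/
theorem smul_mem_of_mem_idealOf {I : TwoSidedIdeal (KumjianPask R Λ hΛ)} {r : R} {H : Set V}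
    (h : ∀ a ∈ H, r • p R Λ hΛ a ∈ I) {x : KumjianPask R Λ hΛ} (hx : x ∈ idealOf R Λ hΛ H) :
    r • x ∈ I := by
  have key : x ∈ colonIdeal I r := by
    refine (TwoSidedIdeal.mem_span_iff.1 hx) _ ?_
    rintro _ ⟨a, ha, rfl⟩
    exact mem_colonIdeal.2 (h a ha)
  exact mem_colonIdeal.1 key

theorem p_mem_idealOf {H : Set V} {a : V} (ha : a ∈ H) : p R Λ hΛ a ∈ idealOf R Λ hΛ H :=
  TwoSidedIdeal.subset_span ⟨a, ha, rfl⟩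

theorem s_mul_t_mem_idealOf {H : Set V} (α : KPath V) {β : KPath V} (hβ : β.s ∈ H) :
    s R Λ hΛ α * t R Λ hΛ β ∈ idealOf R Λ hΛ H := by
  rw [← one_smul R (_ * _)]
  refine smul_s_mul_t_mem _ _ ?_
  rw [one_smul]
  exact p_mem_idealOf hβ

/-- The vertices `a` with `r p_a ∈ I` form a saturated hereditary set. -/
def vertexSet (I : TwoSidedIdeal (KumjianPask R Λ hΛ)) (r : R) : Λ.SatHer :=
  ⟨{a | r • p R Λ hΛ a ∈ I}, by
    refine ⟨fun a n h => ?_, fun α h => ?_⟩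
    · rw [Set.mem_ofPred_eq, (fam).p_eq_sum a n, Finset.smul_sum]
      refine sum_mem fun α hα => smul_s_mul_t_mem α α (h α ((hΛ a n).mem_toFinset.1 hα))
    · rw [Set.mem_ofPred_eq, ← (fam).t_mul_s_self, ← t_mul_p_mul_s Λ R hΛ α rfl, ← smul_mul_assoc,
        ← mul_smul_comm]
      exact I.mul_mem_right _ _ (I.mul_mem_left _ _ h)⟩

end Algebra

end KGraph

/-! ### Aperiodic paths in terms of segments -/

/-- Associativity: `(ωα)(β(ζε)) = (ωγ)ε` for `γ = α(βζ)`. -/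
theorem KPath.regroup {V : Type u} [Category.{v} V] {ω α β ζ ε γ : KPath V} (h1 : ω.s = α.r)
    (h2 : α.s = β.r) (h3 : β.s = ζ.r) (h4 : ζ.s = ε.r) (h : α.comp (β.comp ζ h3) h2 = γ)
    (h5 : ω.s = γ.r) (h6 : γ.s = ε.r) :
    (ω.comp α h1).comp (β.comp (ζ.comp ε h4) h3) h2 = (ω.comp γ h5).comp ε h6 := by
  subst h
  simp [comp]

namespace KGraph

section Segments

variable {k : ℕ} {V : Type u} [Category.{v} V] {Λ : KGraph k V}

/-- The segments `x(p, p + d)` of an infinite path, as a function of the position `p` and the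
degree `d`: an infinite path without reference to functors. -/
structure IsSegmentSystem (Λ : KGraph k V) (ξ : (Fin k → ℕ) → (Fin k → ℕ) → KPath V) : Prop where
  deg_eq : ∀ p d, Λ.deg (ξ p d) = d
  exists_comp : ∀ p d e, ∃ h, (ξ p d).comp (ξ (p + d) e) h = ξ p (d + e)

/-- Two morphisms of a full subcategory, not assumed parallel, agree if they agree as paths of the
ambient category. -/
theorem fullSubcategory_hom_ext {P : ObjectProperty V} {a b a' b' : P.FullSubcategory}
    (f : a ⟶ b) (g : a' ⟶ b') (h : (⟨f.hom⟩ : KPath V) = ⟨g.hom⟩) : a = a' ∧ b = b' ∧ f ≍ g := by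
  obtain ⟨a, ha⟩ := a
  obtain ⟨b, hb⟩ := b
  obtain ⟨a', ha'⟩ := a'
  obtain ⟨b', hb'⟩ := b'
  simp only [KPath.mk.injEq] at h
  obtain ⟨rfl, rfl, h⟩ := h
  exact ⟨rfl, rfl, heq_of_eq (ObjectProperty.hom_ext _ (eq_of_heq h))⟩

/-- In the form of segments, strong aperiodicity gives an aperiodic infinite path outside `H` at
each vertex outside `H`. -/
theorem IsStronglyAperiodic.exists_segments (ha : Λ.IsStronglyAperiodic) (H : Λ.SatHer) {a : V}
    (h : a ∉ H.1) : ∃ ξ, Λ.IsSegmentSystem ξ ∧ (∀ d, (ξ 0 d).r = a) ∧ (∀ p d, (ξ p d).s ∉ H.1) ∧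
      ∀ m n, m ≠ n → ∃ p d, ξ (m + p) d ≠ ξ (n + p) d := by
  obtain ⟨x, hx, hap⟩ := ha H (fun e => h (e ▸ Set.mem_univ a)) ⟨a, h⟩
  let g : ∀ p q : Fin k → ℕ, p ≤ q → KPath V := fun p q hpq =>
    ⟨(x.functor.map (homOfLE (OrderDual.toDual_le_toDual.2 hpq))).hom⟩
  have hg : ∀ {p q p' q' : Fin k → ℕ} (h : p ≤ q) (h' : p' ≤ q'), p = p' → q = q' →
      g p q h = g p' q' h' := by
    rintro p q _ _ h h' rfl rfl
    rfl
  have hcomp : ∀ {p q r : Fin k → ℕ} (h : p ≤ q) (h' : q ≤ r),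
      (g p q h).comp (g q r h') rfl = g p r (h.trans h') := by
    intro p q r h h'
    simp only [g, KPath.comp, eqToHom_refl, Category.id_comp]
    rw [← ObjectProperty.FullSubcategory.comp_hom, ← Functor.map_comp]
    rfl
  refine ⟨fun p d => g p (p + d) le_self_add, ⟨fun p d => ?_, fun p d e => ?_⟩, fun d => ?_,
    fun p d => (x.functor.obj (OrderDual.toDual (p + d))).property, fun m n hmn => ?_⟩
  · exact add_left_cancel (x.d_map p (p + d) le_self_add)
  · exact ⟨rfl, (hcomp le_self_add le_self_add).trans
      (hg (le_self_add.trans le_self_add) le_self_add rfl (add_assoc _ _ _))⟩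
  · exact congrArg (fun y => y.obj) hx
  · by_contra! hcon
    refine hap m n hmn ?_
    have key : ∀ p q (hpq : p ≤ q), g (p + m) (q + m) (add_le_add_left hpq m) =
        g (p + n) (q + n) (add_le_add_left hpq n) := by
      intro p q hpq
      obtain ⟨d, rfl⟩ := exists_add_of_le hpq
      exact (hg (add_le_add_left hpq m) le_self_add (add_comm p m) (by abel)).trans
        ((hcon p d).trans (hg le_self_add (add_le_add_left hpq n) (add_comm n p) (by abel)))
    have hf : (x.shift m).functor = (x.shift n).functor := by
      refine Functor.hext (fun p => ?_) (fun p q f => ?_)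
      · exact (fullSubcategory_hom_ext _ _ (key p.ofDual p.ofDual le_rfl)).1
      · exact (fullSubcategory_hom_ext _ _ (key q.ofDual p.ofDual (leOfHom f))).2.2
    cases h1 : x.shift m
    cases h2 : x.shift n
    simp only [h1, h2] at hf
    simp only [hf]

/-- Two different paths into the range of an aperiodic path have no common extension once they
are prolonged along a long enough part of it. -/
theorem IsSegmentSystem.exists_no_common_extension {ξ : (Fin k → ℕ) → (Fin k → ℕ) → KPath V}
    (hξ : Λ.IsSegmentSystem ξ) (hap : ∀ m n, m ≠ n → ∃ p d, ξ (m + p) d ≠ ξ (n + p) d)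
    {α β : KPath V} (hne : α ≠ β) : ∃ q₀, ∀ q, q₀ ≤ q → ∀ (h1 : α.s = (ξ 0 q).r)
      (h2 : β.s = (ξ 0 q).r) (ε η : KPath V) (h3 : (ξ 0 q).s = ε.r) (h4 : (ξ 0 q).s = η.r),
      (α.comp (ξ 0 q) h1).comp ε h3 ≠ (β.comp (ξ 0 q) h2).comp η h4 := by
  by_cases hd : Λ.deg α = Λ.deg β
  · refine ⟨0, fun q _ h1 h2 ε η h3 h4 he => hne ?_⟩
    rw [KPath.comp_assoc, KPath.comp_assoc] at he
    exact (comp_inj he hd).1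
  -- The segments of `x` in degrees `d(α) ⊔ d(β) + p` of the two extensions differ.
  obtain ⟨m, hm⟩ := exists_add_of_le (le_sup_left : Λ.deg α ≤ Λ.deg α ⊔ Λ.deg β)
  obtain ⟨n, hn⟩ := exists_add_of_le (le_sup_right : Λ.deg β ≤ Λ.deg α ⊔ Λ.deg β)
  have hmn : m ≠ n := by
    rintro rfl
    exact hd (add_right_cancel (hm.symm.trans hn))
  obtain ⟨p, d, hpd⟩ := hap m n hmn
  refine ⟨(m + p + d) ⊔ (n + p + d), fun q hq h1 h2 ε η h3 h4 he => hpd ?_⟩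
  have split : ∀ (j : Fin k → ℕ), j + d ≤ q → ∃ (ζ : KPath V) (h : (ξ 0 j).s = (ξ j d).r)
      (h' : (ξ j d).s = ζ.r), (ξ 0 j).comp ((ξ j d).comp ζ h') h = ξ 0 q := by
    intro j hj
    obtain ⟨e, rfl⟩ := exists_add_of_le hj
    obtain ⟨a1, e1⟩ := hξ.exists_comp 0 (j + d) e
    obtain ⟨a2, e2⟩ := hξ.exists_comp 0 j d
    refine ⟨ξ (0 + (j + d)) e, ?_, ?_, ?_⟩
    · simpa using a2
    · rw [← a1, ← e2]
      simp
    · rw [← KPath.comp_assoc, ← e1]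
      simp only [zero_add] at e2 ⊢
      simp only [e2]
  obtain ⟨ζ, a1, a2, e⟩ := split (m + p) (le_sup_left.trans hq)
  obtain ⟨ζ', a1', a2', e'⟩ := split (n + p) (le_sup_right.trans hq)
  have g1 : α.s = (ξ 0 (m + p)).r := h1.trans (congrArg KPath.r e).symm
  have g2 : β.s = (ξ 0 (n + p)).r := h2.trans (congrArg KPath.r e').symm
  have g3 : ζ.s = ε.r := by
    rw [← h3, ← e]
    rfl
  have g4 : ζ'.s = η.r := by
    rw [← h4, ← e']
    rfl
  have E : (α.comp (ξ 0 (m + p)) g1).comp ((ξ (m + p) d).comp (ζ.comp ε g3) a2) a1 =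
      (β.comp (ξ 0 (n + p)) g2).comp ((ξ (n + p) d).comp (ζ'.comp η g4) a2') a1' := by
    rw [KPath.regroup g1 a1 a2 g3 e h1 h3, KPath.regroup g2 a1' a2' g4 e' h2 h4, he]
  have E' := (comp_inj E (by
    rw [deg_comp, deg_comp, hξ.deg_eq, hξ.deg_eq, ← add_assoc, ← add_assoc, ← hm, ← hn])).2
  exact (comp_inj E' (by rw [hξ.deg_eq, hξ.deg_eq])).1

end Segments

/-! ### Ideals are determined by their vertex coefficients -/

section Algebra

variable {k : ℕ} {V : Type u} [Category.{v} V] {Λ : KGraph k V} {R : Type w} [CommRing R]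
  {hΛ : Λ.RowFinite}

local notation "fam" => isKumjianPaskFamily R Λ hΛ

variable (Λ R hΛ) in
/-- The span of the `s_α s_{β^*}` with `s(α) = s(β)` and `d(β) = n`. -/
def levelSpan (n : Fin k → ℕ) : Submodule R (KumjianPask R Λ hΛ) :=
  Submodule.span R ((fun i : KPath V × KPath V => s R Λ hΛ i.1 * t R Λ hΛ i.2) ''
    {i | i.1.s = i.2.s ∧ Λ.deg i.2 = n})

/-- Inserting `p_{s(β)} = ∑ s_λ s_{λ^*}` in the middle of `s_α s_{β^*}` raises the degree of `β`. -/
theorem levelSpan_le (n m : Fin k → ℕ) : levelSpan Λ R hΛ n ≤ levelSpan Λ R hΛ (n + m) := by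
  refine Submodule.span_le.2 ?_
  rintro _ ⟨⟨α, β⟩, ⟨h, hd⟩, rfl⟩
  dsimp only at h hd ⊢
  rw [← s_mul_p_mul_t Λ R hΛ α (rfl : β.s = β.s), (fam).p_eq_sum _ m, Finset.mul_sum,
    Finset.sum_mul]
  refine sum_mem fun l hl => ?_
  obtain ⟨hlr, hld⟩ := (hΛ _ _).mem_toFinset.1 hl
  have e : s R Λ hΛ α * (s R Λ hΛ l * t R Λ hΛ l) * t R Λ hΛ β =
      s R Λ hΛ (α.comp l (h.trans hlr.symm)) * t R Λ hΛ (β.comp l hlr.symm) := by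
    rw [s_comp, t_comp]
    simp only [mul_assoc]
  rw [e]
  exact Submodule.subset_span ⟨(α.comp l (h.trans hlr.symm), β.comp l hlr.symm),
    ⟨rfl, (Λ.deg_comp β l hlr.symm).trans (by rw [hd, hld])⟩, rfl⟩

theorem exists_mem_levelSpan (x : KumjianPask R Λ hΛ) : ∃ n, x ∈ levelSpan Λ R hΛ n := by
  have hx := mem_coeffSpan_top x
  induction hx using Submodule.span_induction with
  | mem x hx =>
    obtain ⟨r, α, β, h, -, rfl⟩ := hx
    exact ⟨_, Submodule.smul_mem _ _ (Submodule.subset_span ⟨(α, β), ⟨h, rfl⟩, rfl⟩)⟩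
  | zero => exact ⟨0, zero_mem _⟩
  | add x y _ _ hx hy =>
    obtain ⟨n, hn⟩ := hx
    obtain ⟨m, hm⟩ := hy
    exact ⟨n + m, add_mem (levelSpan_le n m hn) (add_comm m n ▸ levelSpan_le m n hm)⟩
  | smul r x _ hx =>
    obtain ⟨n, hn⟩ := hx
    exact ⟨n, Submodule.smul_mem _ _ hn⟩

/-- If `x ∈ I` is a combination of distinct `s_α s_{β^*}` where all `β` have the same degree, then
`r p_{s(β)} ∈ I` for each coefficient `r` of `x`.  Otherwise there is an aperiodic path `y` with
range `s(β)` that avoids the saturated hereditary set of the `a` with `r p_a ∈ I`.  Compressing `x`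
to `(s_{α y(0, q)})^* x s_{β y(0, q)}` kills all other terms for large `q`, which leaves
`r p_{y(q)}`, so that `y(q)` is in that set. -/
theorem coeff_smul_p_mem (ha : Λ.IsStronglyAperiodic) (I : TwoSidedIdeal (KumjianPask R Λ hΛ))
    {n : Fin k → ℕ} (c : KPath V × KPath V →₀ R)
    (hc : ∀ i ∈ c.support, i.1.s = i.2.s ∧ Λ.deg i.2 = n)
    (hI : (c.sum fun i r => r • (s R Λ hΛ i.1 * t R Λ hΛ i.2)) ∈ I)
    {i : KPath V × KPath V} (hi : i ∈ c.support) : c i • p R Λ hΛ i.2.s ∈ I := by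
  classical
  obtain ⟨α, β⟩ := i
  obtain ⟨hαβ, hβ⟩ := hc _ hi
  dsimp only at hαβ hβ ⊢
  by_contra hmem
  obtain ⟨ξ, hξ, hr, hH, hap⟩ := ha.exists_segments (vertexSet I (c (α, β))) hmem
  have hq : ∀ γ : KPath V, ∃ q₀, γ ≠ α → ∀ q, q₀ ≤ q → ∀ (h1 : α.s = (ξ 0 q).r)
      (h2 : γ.s = (ξ 0 q).r) (ε η : KPath V) (h3 : (ξ 0 q).s = ε.r) (h4 : (ξ 0 q).s = η.r),
      (α.comp (ξ 0 q) h1).comp ε h3 ≠ (γ.comp (ξ 0 q) h2).comp η h4 := by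
    intro γ
    by_cases h : γ = α
    · exact ⟨0, fun h' => (h' h).elim⟩
    · obtain ⟨q₀, hq₀⟩ := hξ.exists_no_common_extension hap (Ne.symm h)
      exact ⟨q₀, fun _ => hq₀⟩
  choose q₀ hq₀ using hq
  -- One `q` that is large enough for all terms of `x`.
  let q := c.support.sup fun i => q₀ i.1
  have hα : α.s = (ξ 0 q).r := hαβ.trans (hr q).symm
  have hβ' : β.s = (ξ 0 q).r := (hr q).symm
  have key := I.mul_mem_right _ (s R Λ hΛ (β.comp (ξ 0 q) hβ'))
    (I.mul_mem_left (t R Λ hΛ (α.comp (ξ 0 q) hα)) _ hI)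
  refine hH 0 q ?_
  change _ • _ ∈ I
  convert key using 1
  rw [Finsupp.sum, Finset.mul_sum, Finset.sum_mul, Finset.sum_eq_single_of_mem _ hi]
  · have h1 : t R Λ hΛ (α.comp (ξ 0 q) hα) * s R Λ hΛ α = t R Λ hΛ (ξ 0 q) := by
      rw [t_comp, mul_assoc, (fam).t_mul_s_self, hα, (fam).t_mul_p]
    have h2 : t R Λ hΛ β * s R Λ hΛ (β.comp (ξ 0 q) hβ') = s R Λ hΛ (ξ 0 q) := by
      rw [s_comp, ← mul_assoc, (fam).t_mul_s_self, hβ', (fam).p_mul_s]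
    rw [mul_smul_comm, smul_mul_assoc, ← mul_assoc, h1, mul_assoc, h2, (fam).t_mul_s_self]
  · rintro ⟨γ, δ⟩ hγδ hne
    obtain ⟨h, hδ⟩ := hc _ hγδ
    dsimp only at h hδ ⊢
    rw [mul_smul_comm, smul_mul_assoc]
    by_cases hδβ : δ = β
    · subst hδβ
      have hγ : γ.s = (ξ 0 q).r := h.trans (hr q).symm
      have h2 : t R Λ hΛ δ * s R Λ hΛ (δ.comp (ξ 0 q) hβ') = s R Λ hΛ (ξ 0 q) := by
        rw [s_comp, ← mul_assoc, (fam).t_mul_s_self, hβ', (fam).p_mul_s]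
      have h3 : t R Λ hΛ (α.comp (ξ 0 q) hα) * s R Λ hΛ (γ.comp (ξ 0 q) hγ) ∈
          (⊥ : Submodule R (KumjianPask R Λ hΛ)) :=
        t_mul_s_mem Λ R hΛ _ _ _ fun ε η a1 a2 e =>
          (hq₀ γ (fun e => hne (by rw [e])) q
            (Finset.le_sup (f := fun i : KPath V × KPath V => q₀ i.1) hγδ) hα hγ ε η a1 a2 e).elim
      rw [s_comp, Submodule.mem_bot] at h3
      rw [← mul_assoc, mul_assoc, h2, mul_assoc, h3, smul_zero]
    · have h2 : t R Λ hΛ δ * s R Λ hΛ β = 0 :=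
        (fam).t_mul_s_of_ne _ _ (hδ.trans hβ.symm) hδβ
      rw [s_comp, ← mul_assoc, mul_assoc _ _ (s R Λ hΛ β), mul_assoc _ _ (s R Λ hΛ β), h2]
      simp

/-- The coefficients of an ideal `I` at the vertex `a`: the ideal of the `r` with `r p_a ∈ I`. -/
def idealCoeff (I : TwoSidedIdeal (KumjianPask R Λ hΛ)) (a : V) : Ideal R where
  carrier := {r | r • p R Λ hΛ a ∈ I}
  zero_mem' := by simp [I.zero_mem]
  add_mem' hx hy := by simpa [add_smul] using I.add_mem hx hy
  smul_mem' r x hx := by simpa [mul_smul] using ideal_smul_mem I r hx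

/-- Every ideal is spanned by the `r s_α s_{β^*}` with `r p_{s(β)} ∈ I`. -/
theorem mem_ideal_iff (ha : Λ.IsStronglyAperiodic) (I : TwoSidedIdeal (KumjianPask R Λ hΛ))
    (x : KumjianPask R Λ hΛ) : x ∈ I ↔ x ∈ coeffSpan Λ R hΛ (idealCoeff I) := by
  constructor
  · intro hx
    obtain ⟨n, hn⟩ := exists_mem_levelSpan x
    obtain ⟨c, hc, rfl⟩ := (Finsupp.mem_span_image_iff_linearCombination R).1 hn
    exact sum_mem fun i hi => smul_mem_coeffSpan _ _
      (coeff_smul_p_mem ha I c (fun j hj => hc hj) hx hi)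
  · intro hx
    induction hx using Submodule.span_induction with
    | mem x hx =>
      obtain ⟨r, α, β, -, hr, rfl⟩ := hx
      exact smul_s_mul_t_mem α β hr
    | zero => exact I.zero_mem
    | add x y _ _ hx hy => exact I.add_mem hx hy
    | smul r x _ hx => exact ideal_smul_mem I r hx

end Algebra

end KGraph

namespace KGraph

/-! ### A representation on germs of functions on paths -/

section Germs

variable {k : ℕ} {V : Type u} [Category.{v} V] (Λ : KGraph k V) (R : Type w) [CommRing R]

open scoped Classical in
/-- The operator `f ↦ (λ ↦ f(αλ))`, where `f(αλ) = 0` if `αλ` is not defined. -/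
noncomputable def pullLin (α : KPath V) : (KPath V → R) →ₗ[R] (KPath V → R) where
  toFun f l := if h : α.s = l.r then f (α.comp l h) else 0
  map_add' f g := by
    ext l
    by_cases h : α.s = l.r <;> simp [h]
  map_smul' r f := by
    ext l
    by_cases h : α.s = l.r <;> simp [h]

open scoped Classical in
/-- The operator that maps `f` to the function with the value `f(μ)` at `αμ` and with the value `0`
at all paths that do not begin with `α`. -/
noncomputable def pushLin (α : KPath V) : (KPath V → R) →ₗ[R] (KPath V → R) where
  toFun f l := if h : ∃ μ, ∃ e : α.s = μ.r, α.comp μ e = l then f h.choose else 0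
  map_add' f g := by
    ext l
    by_cases h : ∃ μ, ∃ e : α.s = μ.r, α.comp μ e = l <;> simp [h]
  map_smul' r f := by
    ext l
    by_cases h : ∃ μ, ∃ e : α.s = μ.r, α.comp μ e = l <;> simp [h]

open scoped Classical in
/-- The restriction of functions to the paths with range `a`. -/
noncomputable def restrictLin (a : V) : (KPath V → R) →ₗ[R] (KPath V → R) where
  toFun f l := if l.r = a then f l else 0
  map_add' f g := by
    ext l
    by_cases h : l.r = a <;> simp [h]
  map_smul' r f := by
    ext l
    by_cases h : l.r = a <;> simp [h]

variable {R}

theorem pullLin_apply {α l : KPath V} (h : α.s = l.r) (f : KPath V → R) :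
    pullLin R α f l = f (α.comp l h) := dif_pos h

theorem pullLin_apply_of_ne {α l : KPath V} (h : α.s ≠ l.r) (f : KPath V → R) :
    pullLin R α f l = 0 := dif_neg h

theorem pushLin_comp (Λ : KGraph k V) {α μ : KPath V} (h : α.s = μ.r) (f : KPath V → R) :
    pushLin R α f (α.comp μ h) = f μ := by
  have hex : ∃ μ', ∃ e : α.s = μ'.r, α.comp μ' e = α.comp μ h := ⟨μ, h, rfl⟩
  refine (dif_pos hex).trans (congrArg f ?_)
  obtain ⟨e, he⟩ := hex.choose_spec
  exact (comp_inj (Λ := Λ) he rfl).2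

theorem pushLin_apply_of_not {α l : KPath V} (f : KPath V → R)
    (h : ∀ μ (e : α.s = μ.r), α.comp μ e ≠ l) : pushLin R α f l = 0 :=
  dif_neg fun ⟨μ, e, he⟩ => h μ e he

theorem restrictLin_apply {a : V} {l : KPath V} (h : l.r = a) (f : KPath V → R) :
    restrictLin R a f l = f l := if_pos h

theorem restrictLin_apply_of_ne {a : V} {l : KPath V} (h : l.r ≠ a) (f : KPath V → R) :
    restrictLin R a f l = 0 := if_neg h

/-- To compare two functions with `pushLin R α f`, look at the paths `αμ` and at the others. -/
theorem eq_pushLin (Λ : KGraph k V) {α : KPath V} {f g : KPath V → R}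
    (h1 : ∀ μ (e : α.s = μ.r), g (α.comp μ e) = f μ)
    (h2 : ∀ l, (∀ μ (e : α.s = μ.r), α.comp μ e ≠ l) → g l = 0) : g = pushLin R α f := by
  funext l
  by_cases h : ∃ μ, ∃ e : α.s = μ.r, α.comp μ e = l
  · obtain ⟨μ, e, rfl⟩ := h
    rw [h1, pushLin_comp Λ]
  · push Not at h
    rw [h2 l h, pushLin_apply_of_not f h]

theorem pushLin_pushLin (Λ : KGraph k V) {α β : KPath V} (h : α.s = β.r) (f : KPath V → R) :
    pushLin R α (pushLin R β f) = pushLin R (α.comp β h) f := by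
  refine eq_pushLin Λ (fun μ e => ?_) (fun l hl => ?_)
  · have e' : β.s = μ.r := e
    rw [KPath.comp_assoc α β μ h e']
    exact (pushLin_comp Λ (μ := β.comp μ e') h _).trans (pushLin_comp Λ e' f)
  · by_cases h' : ∃ μ, ∃ e : α.s = μ.r, α.comp μ e = l
    · obtain ⟨μ, e, rfl⟩ := h'
      rw [pushLin_comp Λ]
      refine pushLin_apply_of_not _ fun ν e' he => hl ν e' ?_
      subst he
      exact KPath.comp_assoc _ _ _ _ _
    · push Not at h'
      exact pushLin_apply_of_not _ h'

theorem pushLin_id (Λ : KGraph k V) (a : V) (f : KPath V → R) :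
    restrictLin R a f = pushLin R ⟨𝟙 a⟩ f := by
  refine eq_pushLin Λ (fun μ e => ?_) (fun l hl => ?_)
  · rw [KPath.id_comp]
    exact restrictLin_apply e.symm f
  · exact restrictLin_apply_of_ne (fun h => hl l h.symm (KPath.id_comp _ _)) f

theorem restrictLin_pushLin (Λ : KGraph k V) (α : KPath V) (f : KPath V → R) :
    restrictLin R α.r (pushLin R α f) = pushLin R α f := by
  refine eq_pushLin Λ (fun μ e => ?_) (fun l hl => ?_)
  · exact (restrictLin_apply rfl _).trans (pushLin_comp Λ e f)
  · by_cases h : l.r = α.r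
    · rw [restrictLin_apply h, pushLin_apply_of_not f hl]
    · exact restrictLin_apply_of_ne h _

theorem pushLin_restrictLin (Λ : KGraph k V) (α : KPath V) (f : KPath V → R) :
    pushLin R α (restrictLin R α.s f) = pushLin R α f := by
  refine eq_pushLin Λ (fun μ e => ?_) (fun l hl => pushLin_apply_of_not _ hl)
  rw [pushLin_comp Λ, restrictLin_apply e.symm]

theorem pullLin_pullLin {α β : KPath V} (h : α.s = β.r) (f : KPath V → R) :
    pullLin R β (pullLin R α f) = pullLin R (α.comp β h) f := by
  funext l
  by_cases e : β.s = l.r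
  · rw [pullLin_apply e, pullLin_apply (by exact h), pullLin_apply (by exact e),
      KPath.comp_assoc]
  · rw [pullLin_apply_of_ne e, pullLin_apply_of_ne (by exact e)]

theorem pullLin_id (a : V) (f : KPath V → R) : pullLin R ⟨𝟙 a⟩ f = restrictLin R a f := by
  funext l
  by_cases e : a = l.r
  · rw [pullLin_apply (by exact e), restrictLin_apply e.symm, KPath.id_comp]
  · rw [pullLin_apply_of_ne (by exact e), restrictLin_apply_of_ne (Ne.symm e)]

theorem restrictLin_pullLin (α : KPath V) (f : KPath V → R) :
    restrictLin R α.s (pullLin R α f) = pullLin R α f := by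
  funext l
  by_cases e : l.r = α.s
  · rw [restrictLin_apply e]
  · rw [restrictLin_apply_of_ne e, pullLin_apply_of_ne (Ne.symm e)]

theorem pullLin_restrictLin (α : KPath V) (f : KPath V → R) :
    pullLin R α (restrictLin R α.r f) = pullLin R α f := by
  funext l
  by_cases e : α.s = l.r
  · rw [pullLin_apply e, pullLin_apply e]
    exact restrictLin_apply rfl f
  · rw [pullLin_apply_of_ne e, pullLin_apply_of_ne e]

theorem pullLin_pushLin (Λ : KGraph k V) (α : KPath V) (f : KPath V → R) :
    pullLin R α (pushLin R α f) = restrictLin R α.s f := by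
  funext l
  by_cases e : α.s = l.r
  · rw [pullLin_apply e, pushLin_comp Λ, restrictLin_apply e.symm]
  · rw [pullLin_apply_of_ne e, restrictLin_apply_of_ne (Ne.symm e)]

theorem pullLin_pushLin_of_ne {α β : KPath V} (hd : Λ.deg α = Λ.deg β) (h : α ≠ β)
    (f : KPath V → R) : pullLin R α (pushLin R β f) = 0 := by
  funext l
  by_cases e : α.s = l.r
  · rw [pullLin_apply e]
    exact pushLin_apply_of_not f fun μ e' he => h (comp_inj he hd.symm).1.symm
  · exact pullLin_apply_of_ne e _

/-- The last Kumjian–Pask relation holds only at paths of degree at least `n`; this is why functions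
have to be taken modulo those that vanish in large degrees. -/
theorem sum_pushLin_pullLin (hΛ : Λ.RowFinite) (a : V) (n : Fin k → ℕ) (f : KPath V → R)
    (l : KPath V) (hl : n ≤ Λ.deg l) :
    ∑ α ∈ (hΛ a n).toFinset, pushLin R α (pullLin R α f) l = restrictLin R a f l := by
  obtain ⟨m, hm⟩ := exists_add_of_le hl
  obtain ⟨α, μ, e, hα, -, rfl⟩ := Λ.exists_eq_comp hm
  have hne : ∀ β ∈ (hΛ a n).toFinset, β ≠ α →
      pushLin R β (pullLin R β f) (α.comp μ e) = 0 := fun β hβ hβα =>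
    pushLin_apply_of_not _ fun ν e' he => hβα
      (comp_inj he (((hΛ _ _).mem_toFinset.1 hβ).2.trans hα.symm)).1
  by_cases ha : α.r = a
  · rw [Finset.sum_eq_single_of_mem α ((hΛ _ _).mem_toFinset.2 ⟨ha, hα⟩) hne, pushLin_comp Λ,
      pullLin_apply e, restrictLin_apply (by exact ha)]
  · rw [restrictLin_apply_of_ne (by exact ha)]
    refine Finset.sum_eq_zero fun β hβ => hne β hβ ?_
    rintro rfl
    exact ha ((hΛ _ _).mem_toFinset.1 hβ).1

/-- The functions whose value at `λ` lies in the ideal `D (s(λ))` for all `λ` of large enough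
degree. -/
def negligible (D : V → Ideal R) : Submodule R (KPath V → R) where
  carrier := {f | ∃ n, ∀ l, n ≤ Λ.deg l → f l ∈ D l.s}
  zero_mem' := ⟨0, fun l _ => zero_mem _⟩
  add_mem' := by
    rintro f g ⟨n, hn⟩ ⟨m, hm⟩
    exact ⟨n ⊔ m, fun l hl => add_mem (hn l (le_sup_left.trans hl)) (hm l (le_sup_right.trans hl))⟩
  smul_mem' := by
    rintro r f ⟨n, hn⟩
    exact ⟨n, fun l hl => (D l.s).mul_mem_left r (hn l hl)⟩

variable (D : V → Ideal R)

theorem negligible_le_restrictLin (a : V) :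
    Λ.negligible D ≤ (Λ.negligible D).comap (restrictLin R a) := by
  rintro f ⟨n, hn⟩
  refine ⟨n, fun l hl => ?_⟩
  by_cases h : l.r = a
  · rw [restrictLin_apply h]
    exact hn l hl
  · rw [restrictLin_apply_of_ne h]
    exact zero_mem _

theorem negligible_le_pullLin (α : KPath V) :
    Λ.negligible D ≤ (Λ.negligible D).comap (pullLin R α) := by
  rintro f ⟨n, hn⟩
  refine ⟨n, fun l hl => ?_⟩
  by_cases h : α.s = l.r
  · rw [pullLin_apply h]
    refine hn (α.comp l h) (hl.trans ?_)
    rw [deg_comp]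
    exact le_add_self
  · rw [pullLin_apply_of_ne h]
    exact zero_mem _

theorem negligible_le_pushLin (α : KPath V) :
    Λ.negligible D ≤ (Λ.negligible D).comap (pushLin R α) := by
  rintro f ⟨n, hn⟩
  refine ⟨Λ.deg α + n, fun l hl => ?_⟩
  by_cases h : ∃ μ, ∃ e : α.s = μ.r, α.comp μ e = l
  · obtain ⟨μ, e, rfl⟩ := h
    rw [pushLin_comp Λ]
    rw [deg_comp] at hl
    exact hn μ (le_of_add_le_add_left hl)
  · push Not at h
    rw [pushLin_apply_of_not f h]
    exact zero_mem _

/-- The functions on paths modulo the negligible ones. -/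
abbrev Germ : Type _ := (KPath V → R) ⧸ Λ.negligible D

/-- The action of `p_a` on germs. -/
noncomputable def germP (a : V) : Module.End R (Λ.Germ D) :=
  (Λ.negligible D).mapQ _ (restrictLin R a) (Λ.negligible_le_restrictLin D a)

/-- The action of `s_α` on germs. -/
noncomputable def germS (α : KPath V) : Module.End R (Λ.Germ D) :=
  (Λ.negligible D).mapQ _ (pushLin R α) (Λ.negligible_le_pushLin D α)

/-- The action of `s_{α^*}` on germs. -/
noncomputable def germT (α : KPath V) : Module.End R (Λ.Germ D) :=
  (Λ.negligible D).mapQ _ (pullLin R α) (Λ.negligible_le_pullLin D α)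

variable {Λ D}

theorem germ_ext {F G : Module.End R (Λ.Germ D)}
    (h : ∀ f, F ((Λ.negligible D).mkQ f) = G ((Λ.negligible D).mkQ f)) : F = G :=
  Submodule.linearMap_qext _ (LinearMap.ext h)

variable (Λ D)

theorem isKumjianPaskFamily_germ (hΛ : Λ.RowFinite) :
    Λ.IsKumjianPaskFamily hΛ (Λ.germP D) (Λ.germS D) (Λ.germT D) where
  s_id a := germ_ext fun f => congrArg (Submodule.mkQ _) (pushLin_id Λ a f).symm
  t_id a := germ_ext fun f => congrArg (Submodule.mkQ _) (pullLin_id a f)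
  p_mul_self a := germ_ext fun f => congrArg (Submodule.mkQ _) (by
    funext l
    by_cases h : l.r = a
    · rw [restrictLin_apply h]
    · rw [restrictLin_apply_of_ne h, restrictLin_apply_of_ne h])
  p_mul_of_ne a b hab := germ_ext fun f => congrArg (Submodule.mkQ _)
    (show restrictLin R a (restrictLin R b f) = 0 by
      funext l
      by_cases h : l.r = a
      · rw [restrictLin_apply h]
        exact restrictLin_apply_of_ne (by rwa [h]) f
      · exact restrictLin_apply_of_ne h _)
  s_mul_s α β := germ_ext fun f => congrArg (Submodule.mkQ _)
    ((pushLin_pushLin Λ rfl f).trans (by rw [KPath.mk_comp_mk]))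
  t_mul_t α β := germ_ext fun f => congrArg (Submodule.mkQ _)
    ((pullLin_pullLin rfl f).trans (by rw [KPath.mk_comp_mk]))
  p_mul_s α := germ_ext fun f => congrArg (Submodule.mkQ _) (restrictLin_pushLin Λ α f)
  s_mul_p α := germ_ext fun f => congrArg (Submodule.mkQ _) (pushLin_restrictLin Λ α f)
  p_mul_t α := germ_ext fun f => congrArg (Submodule.mkQ _) (restrictLin_pullLin α f)
  t_mul_p α := germ_ext fun f => congrArg (Submodule.mkQ _) (pullLin_restrictLin α f)
  t_mul_s_self α := germ_ext fun f => congrArg (Submodule.mkQ _) (pullLin_pushLin Λ α f)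
  t_mul_s_of_ne α β hd h := germ_ext fun f => congrArg (Submodule.mkQ _)
    (pullLin_pushLin_of_ne Λ hd h f)
  p_eq_sum a n := germ_ext fun f => by
    have e : (∑ α ∈ (hΛ a n).toFinset, Λ.germS D α * Λ.germT D α) ((Λ.negligible D).mkQ f) =
        (Λ.negligible D).mkQ (∑ α ∈ (hΛ a n).toFinset, pushLin R α (pullLin R α f)) := by
      rw [LinearMap.sum_apply, map_sum]
      rfl
    rw [e]
    refine (Submodule.Quotient.eq _).2 ⟨n, fun l hl => ?_⟩
    rw [Pi.sub_apply, Finset.sum_apply, sum_pushLin_pullLin Λ hΛ a n f l hl, sub_self]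
    exact zero_mem _

variable {Λ D}

/-- The coefficients are saturated: `r ∈ D a` if `r ∈ D (s(α))` for all `α ∈ aΛ^n`. -/
def CoeffSaturated (Λ : KGraph k V) (D : V → Ideal R) : Prop :=
  ∀ (a : V) (n : Fin k → ℕ) (r : R), (∀ α ∈ Λ.pathsTo a n, r ∈ D α.s) → r ∈ D a

/-- The span of the `r s_α s_{β^*}` with `r ∈ D (s(β))` acts on germs as zero, while `r p_a` maps
the germ of the constant function `1` to a nonzero germ unless `r ∈ D a`. -/
theorem mem_of_smul_p_mem_coeffSpan {hΛ : Λ.RowFinite} (hD : CoeffHereditary D)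
    (hS : Λ.CoeffSaturated D) {r : R} {a : V}
    (h : r • p R Λ hΛ a ∈ coeffSpan Λ R hΛ D) : r ∈ D a := by
  obtain ⟨φ, ⟨hp, hs, ht⟩, -⟩ := existsUnique_lift R Λ hΛ (Λ.isKumjianPaskFamily_germ D hΛ)
  have hzero : ∀ x ∈ coeffSpan Λ R hΛ D, φ x = 0 := by
    intro x hx
    induction hx using Submodule.span_induction with
    | mem x hx =>
      obtain ⟨c, α, β, hαβ, hc, rfl⟩ := hx
      rw [map_smul, map_mul, hs, ht]
      refine germ_ext fun f => (Submodule.Quotient.mk_eq_zero _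
        (x := c • pushLin R α (pullLin R β f))).2 ⟨0, fun l _ => ?_⟩
      by_cases hl : ∃ μ, ∃ e : α.s = μ.r, α.comp μ e = l
      · obtain ⟨μ, e, rfl⟩ := hl
        rw [Pi.smul_apply, pushLin_comp Λ, smul_eq_mul]
        refine (D μ.s).mul_mem_right _ (hD μ ?_)
        rwa [← e, hαβ]
      · push Not at hl
        rw [Pi.smul_apply, pushLin_apply_of_not _ hl, smul_zero]
        exact zero_mem _
    | zero => exact map_zero φ
    | add x y _ _ hx hy => rw [map_add, hx, hy, add_zero]
    | smul c x _ hx => rw [map_smul, hx, smul_zero]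
  have h1 := hzero _ h
  rw [map_smul, hp] at h1
  have h2 : (Λ.negligible D).mkQ (r • restrictLin R a fun _ => 1) = 0 :=
    congrArg (fun F : Module.End R (Λ.Germ D) => F ((Λ.negligible D).mkQ fun _ => 1)) h1
  obtain ⟨n, hn⟩ := (Submodule.Quotient.mk_eq_zero _).1 h2
  refine hS a n r fun α hα => ?_
  have := hn α hα.2.ge
  rwa [Pi.smul_apply, restrictLin_apply hα.1, smul_eq_mul, mul_one] at this

end Germs
end KGraph

namespace KGraph

/-! ### Ideals and functions on saturated hereditary sets -/

section Lattice

variable {k : ℕ} {V : Type u} [Category.{v} V] {Λ : KGraph k V} {R : Type w} [CommRing R]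
  {hΛ : Λ.RowFinite}

theorem subset_join {𝒜 : Set Λ.SatHer} {K : Λ.SatHer} (hK : K ∈ 𝒜) : K.1 ⊆ (Λ.join 𝒜).1 :=
  Set.subset_iInter₂ fun _ hH => hH K hK

theorem join_subset {𝒜 : Set Λ.SatHer} {H : Λ.SatHer} (h : ∀ K ∈ 𝒜, K.1 ⊆ H.1) :
    (Λ.join 𝒜).1 ⊆ H.1 :=
  Set.iInter₂_subset H h

theorem JoinToInf.antitone (π : Λ.JoinToInf R) {H K : Λ.SatHer} (h : H.1 ⊆ K.1) :
    π.1 K ≤ π.1 H := by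
  have e : Λ.join {H, K} = K := by
    refine Subtype.ext (Set.Subset.antisymm (join_subset ?_) (subset_join (by simp)))
    rintro L (rfl | rfl)
    exacts [h, subset_rfl]
  have := π.2 {H, K}
  rw [e] at this
  rw [this]
  exact iInf₂_le H (by simp)

variable (Λ) in
/-- The smallest saturated hereditary set that contains the vertex `a`. -/
def closureOf (a : V) : Λ.SatHer :=
  ⟨⋂ (H : Λ.SatHer) (_ : a ∈ H.1), H.1, by
    refine ⟨fun v n h => ?_, fun α h => ?_⟩
    · simp only [Set.mem_iInter] at h ⊢
      exact fun H hH => H.2.1 v n fun α hα => h α hα H hH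
    · simp only [Set.mem_iInter] at h ⊢
      exact fun H hH => H.2.2 α (h H hH)⟩

theorem mem_closureOf (a : V) : a ∈ (Λ.closureOf a).1 := Set.mem_iInter₂.2 fun _ h => h

theorem closureOf_subset {a : V} {H : Λ.SatHer} (h : a ∈ H.1) : (Λ.closureOf a).1 ⊆ H.1 :=
  Set.iInter₂_subset H h

/-- The coefficients on vertices given by a function on saturated hereditary sets. -/
def JoinToInf.coeff (π : Λ.JoinToInf R) (a : V) : Ideal R := π.1 (Λ.closureOf a)

theorem JoinToInf.mem_coeff_of_mem (π : Λ.JoinToInf R) {H : Λ.SatHer} {r : R} (hr : r ∈ π.1 H)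
    {a : V} (ha : a ∈ H.1) : r ∈ π.coeff a :=
  π.antitone (closureOf_subset ha) hr

/-- If `H` is contained in the join of the sets generated by a family of vertices, then `π(H)`
contains the common coefficients of the family. -/
theorem JoinToInf.mem_of_forall_coeff (π : Λ.JoinToInf R) {H : Λ.SatHer} {r : R} (A : Set V)
    (hA : H.1 ⊆ (Λ.join (Λ.closureOf '' A)).1) (h : ∀ a ∈ A, r ∈ π.coeff a) : r ∈ π.1 H := by
  refine π.antitone hA ?_
  rw [π.2]
  simp only [Submodule.mem_iInf]
  rintro _ ⟨a, ha, rfl⟩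
  exact h a ha

theorem JoinToInf.mem_iff (π : Λ.JoinToInf R) {H : Λ.SatHer} {r : R} :
    r ∈ π.1 H ↔ ∀ a ∈ H.1, r ∈ π.coeff a :=
  ⟨fun hr _ ha => π.mem_coeff_of_mem hr ha, fun h => π.mem_of_forall_coeff H.1
    (fun a ha => subset_join (Set.mem_image_of_mem _ ha) (mem_closureOf a)) h⟩

theorem JoinToInf.coeffHereditary (π : Λ.JoinToInf R) : CoeffHereditary π.coeff := fun α _ hr =>
  π.mem_coeff_of_mem hr ((Λ.closureOf α.r).2.2 α (mem_closureOf α.r))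

theorem JoinToInf.coeffSaturated (π : Λ.JoinToInf R) : Λ.CoeffSaturated π.coeff := by
  intro a n r h
  refine π.mem_of_forall_coeff (KPath.s '' Λ.pathsTo a n) (closureOf_subset ?_) ?_
  · exact (Λ.join _).2.1 a n fun α hα =>
      subset_join (Set.mem_image_of_mem _ (Set.mem_image_of_mem _ hα)) (mem_closureOf α.s)
  · rintro _ ⟨α, hα, rfl⟩
    exact h α hα

/-- Since `π` is antitone, the span that defines `Γ(π)` is the span with the coefficients
`π(H)`, `H` the saturated hereditary set generated by a vertex. -/
theorem gammaSpan_eq (π : Λ.JoinToInf R) :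
    gammaSpan R Λ hΛ π.1 = coeffSpan Λ R hΛ π.coeff := by
  refine le_antisymm (Submodule.span_le.2 ?_) (Submodule.span_mono ?_)
  · rintro _ ⟨r, μ, ν, rfl, H, hr, hH⟩
    refine mem_coeffIdeal.1 (smul_mem_of_mem_idealOf (I := coeffIdeal π.coeff π.coeffHereditary)
      (fun a ha => mem_coeffIdeal.2 ?_) hH)
    rw [p_eq_s_mul_t]
    exact smul_mem_coeffSpan _ _ (π.mem_coeff_of_mem hr ha)
  · rintro _ ⟨r, α, β, -, hr, rfl⟩
    exact ⟨r, α, β, rfl, Λ.closureOf β.s, hr, s_mul_t_mem_idealOf α (mem_closureOf β.s)⟩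

variable (hΛ) in
/-- The ideal `Γ(π)`. -/
def gammaIdeal (π : Λ.JoinToInf R) : TwoSidedIdeal (KumjianPask R Λ hΛ) :=
  coeffIdeal π.coeff π.coeffHereditary

theorem smul_p_mem_gammaIdeal {π : Λ.JoinToInf R} {r : R} {a : V} :
    r • p R Λ hΛ a ∈ gammaIdeal hΛ π ↔ r ∈ π.coeff a := by
  refine mem_coeffIdeal.trans
    ⟨mem_of_smul_p_mem_coeffSpan π.coeffHereditary π.coeffSaturated, fun h => ?_⟩
  rw [p_eq_s_mul_t]
  exact smul_mem_coeffSpan _ _ h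

theorem gammaIdeal_le_iff {π₁ π₂ : Λ.JoinToInf R} :
    gammaIdeal hΛ π₁ ≤ gammaIdeal hΛ π₂ ↔ ∀ H : Λ.SatHer, π₁.1 H ≤ π₂.1 H := by
  constructor
  · exact fun h H r hr => π₂.mem_iff.2 fun a ha =>
      smul_p_mem_gammaIdeal.1 (h (smul_p_mem_gammaIdeal.2 (π₁.mem_iff.1 hr a ha)))
  · intro h x hx
    refine mem_coeffIdeal.2 (Submodule.span_mono ?_ (mem_coeffIdeal.1 hx))
    rintro _ ⟨r, α, β, hαβ, hr, rfl⟩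
    exact ⟨r, α, β, hαβ, h _ hr, rfl⟩

/-- The function that maps `H` to the ideal of the `r` with `r p_a ∈ I` for all `a ∈ H`. -/
def idealToJoinToInf (I : TwoSidedIdeal (KumjianPask R Λ hΛ)) : Λ.JoinToInf R :=
  ⟨fun H => ⨅ a ∈ H.1, idealCoeff I a, fun 𝒜 => by
    ext r
    -- Both sides say that the saturated hereditary set of the `a` with `r p_a ∈ I` contains
    -- every member of `𝒜`.
    have key : ∀ H : Λ.SatHer, r ∈ (⨅ a ∈ H.1, idealCoeff I a) ↔ H.1 ⊆ (vertexSet I r).1 := by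
      intro H
      simp only [Submodule.mem_iInf]
      rfl
    exact (key _).trans ⟨fun h => (Submodule.mem_iInf _).2 fun K => (Submodule.mem_iInf _).2
      fun hK => (key K).2 ((subset_join hK).trans h), fun h => join_subset fun K hK =>
        (key K).1 ((Submodule.mem_iInf _).1 ((Submodule.mem_iInf _).1 h K) hK)⟩⟩

theorem idealToJoinToInf_coeff (I : TwoSidedIdeal (KumjianPask R Λ hΛ)) :
    (idealToJoinToInf I).coeff = idealCoeff I := by
  ext a r
  change r ∈ (⨅ b ∈ (Λ.closureOf a).1, idealCoeff I b) ↔ _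
  simp only [Submodule.mem_iInf]
  exact ⟨fun h => h a (mem_closureOf a), fun h =>
    closureOf_subset (H := vertexSet I r) h⟩

theorem gammaIdeal_bijective (ha : Λ.IsStronglyAperiodic) :
    Function.Bijective (gammaIdeal (R := R) hΛ) := by
  refine ⟨fun π₁ π₂ h => Subtype.ext (funext fun H => le_antisymm
    (gammaIdeal_le_iff.1 h.le H) (gammaIdeal_le_iff.1 h.ge H)), fun I => ⟨idealToJoinToInf I, ?_⟩⟩
  ext x
  rw [mem_ideal_iff ha I, ← idealToJoinToInf_coeff]
  exact mem_coeffIdeal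

end Lattice

end KGraph

theorem theorem6p3 {k : ℕ} (hk : 0 < k) {V : Type u} [Category.{v} V] (Λ : KGraph k V)
    (hΛ : Λ.RowFinite) (hs : Λ.NoSources) (ha : Λ.IsStronglyAperiodic)
    (R : Type w) [CommRing R] :
    (∀ I : TwoSidedIdeal (Λ.KumjianPask R hΛ),
      (I : Set (Λ.KumjianPask R hΛ)) =
        Submodule.span R {x | ∃ (r : R) (α β : KPath V),
          x = r • (Λ.s R hΛ α * Λ.t R hΛ β) ∧ r • Λ.p R hΛ β.s ∈ I}) ∧
    ∃ Γ : Λ.JoinToInf R → TwoSidedIdeal (Λ.KumjianPask R hΛ),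
      (∀ π, (Γ π : Set (Λ.KumjianPask R hΛ)) = Λ.gammaSpan R hΛ π.1) ∧
      Function.Bijective Γ ∧
      ∀ π₁ π₂, Γ π₁ ≤ Γ π₂ ↔ ∀ H : Λ.SatHer, π₁.1 H ≤ π₂.1 H := by
  refine ⟨fun I => Set.ext fun x => (KGraph.mem_ideal_iff ha I x).trans ?_,
    KGraph.gammaIdeal hΛ, fun π => ?_, KGraph.gammaIdeal_bijective ha,
    fun _ _ => KGraph.gammaIdeal_le_iff⟩
  · -- The two spans differ only in the generators with `s(α) ≠ s(β)`, which are zero.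
    constructor
    · refine fun hx => Submodule.span_mono ?_ hx
      rintro _ ⟨r, α, β, -, hr, rfl⟩
      exact ⟨r, α, β, rfl, hr⟩
    · refine fun hx => Submodule.span_le.2 ?_ hx
      rintro _ ⟨r, α, β, rfl, hr⟩
      exact KGraph.smul_mem_coeffSpan α β hr
  · rw [KGraph.gammaSpan_eq]
    exact Set.ext fun x => KGraph.mem_coeffIdeal
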